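/- **Setting.** Let $F^{\rm in},F^{\rm out}$ be probability distributions on $\{0,1,2,\dots\}$, let $\mathscr N\sim F^{\rm in}$, $\mathscr D\sim F^{\rm out}$, and suppose that for some $\alpha>1$, $\beta>2$ and some slowly varying functions $L_{\rm in},L_{\rm out}$ we have $P(\mathscr N>x)\le x^{-\alpha}L_{\rm in}(x)$ and $P(\mathscr D>x)\le x^{-\beta}L_{\rm out}(x)$ for all $x>0$. Suppose that $\mu:=E[\mathscr N]=E[\mathscr D]>1$. Put $\kappa_0=\min\{1-\alpha^{-1},1-\beta^{-1},1/2\}$ and fix $0<\delta_0<\kappa_0$, $c\in(0,1)$ and $r_0\ge 0$. *Bi-degree sequence (Algorithm 1).* Sample i.i.d. $\mathscr N_1,\dots,\mathscr N_n\sim F^{\rm in}$ and, independently, i.i.d. $\mathscr D_1,\dots,\mathscr D_n\sim F^{\rm out}$, and repeat until $\Delta_n:=\sum_{i=1}^n(\mathscr N_i-\mathscr D_i)$ satisfies $|\Delta_n|\le n^{1-\kappa_0+\delta_0}$. Then choose $|\Delta_n|$ nodes uniformly at random without replacement. For these nodes put $N_i=\mathscr N_i+1$, $D_i=\mathscr D_i$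 if $\Delta_n<0$, and $N_i=\mathscr N_i$, $D_i=\mathscr D_i+1$ if $\Delta_n\ge0$; for all other nodes put $N_i=\mathscr N_i$, $D_i=\mathscr D_i$. Let $L_n=\sum_i N_i=\sum_i D_i$. *Graph and coupled tree.* Node $i$ has $N_i$ inbound and $D_i$ outbound stubs. Choose a root node (called node 1) uniformly at random. Starting from it, pair the inbound stubs one at a time, in breadth-first order. For each of them draw outbound stubs independently and uniformly, with replacement, from all $L_n$ outbound stubs until one is drawn that is not yet paired; pair the inbound stub with it, which makes an edge from the owner of the outbound stub to the owner of the inbound stub, and attach the former to the explored graph if it is new. When the explored part has no unpaired inbound stub left, continue with the inbound stubs of the remaining nodes. The result is the directed configuration model on $n$ nodes. The *thorny branching tree* is built from the same draws: its root is a copy of node 1, and the $t$-th individual born, in breadth-first order, is a copy of the node that owns the first outbound stub drawn at the $t$-th pairing step, whether or not that stub was already paired (draws continue in the same way if the tree outgrows the graph). A copy of node $j$ has $N_j$ offspring and $D_j$ outbound stubs, of which (if it is not the root) one points to its parent and the others point outside the tree. *PageRank.* Let $M_{ij}=c\,s_{ij}/D_i$ if there are $s_{ij}\ge1$ edges from $i$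 to $j$, and $M_{ij}=0$ otherwise. The scale-free PageRank $\mathbf R^{(n,\infty)}$ of the graph is the solution of $\mathbf R=\mathbf R M+(1-c)\mathbf 1$, and $R_1^{(n,\infty)}$ is its value at the root. On the tree put $\hat R_i^{(n,0)}=r_0$ and $\hat R_i^{(n,k)}=(1-c)+\sum_{j\to i}\frac{c}{\hat D_j}\hat R_j^{(n,k-1)}$ for $k\ge1$, where the sum is over the offspring $j$ of $i$ and $\hat D_j$ is the number of outbound stubs of $j$; $\hat R_1^{(n,k)}$ is the value at the root. **Theorem.** For every $\epsilon>0$ and every $0<h<1/(2\log\mu)$ there are $\delta>0$ and a constant $C$ such that for all sufficiently large $n$ the bi-degree sequence is well defined (the algorithm accepts with positive probability) and, for all integers $k$ with $1\le k\le h\log n$, $$P\left(\left|R_1^{(n,\infty)}-\hat R_1^{(n,k)}\right|>\epsilon\right)\le (r_0+1)\,\epsilon^{-1}c^k+C\,n^{-\delta}.$$ -/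

import Mathlib

open MeasureTheory ProbabilityTheory Filter Topology

noncomputable section

namespace DCM

/-! ### Slow variation and tails -/

/-- A (measurable, positive) function on `(0, ∞)` that is slowly varying at infinity. -/
structure SlowlyVarying (L : ℝ → ℝ) : Prop where
  measurable : Measurable L
  pos : ∀ x, 0 < x → 0 < L x
  tendsto : ∀ t, 0 < t → Tendsto (fun x => L (t * x) / L x) atTop (𝓝 1)

/-- The distribution `F` on `ℕ` satisfies `P(X > x) ≤ x ^ (-a) * L x` for all `x > 0`, for some
slowly varying `L`. -/
def TailBound (F : Measure ℕ) (a : ℝ) : Prop :=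
  ∃ L : ℝ → ℝ, SlowlyVarying L ∧ ∀ x : ℝ, 0 < x → F.real {k : ℕ | x < k} ≤ x ^ (-a) * L x

/-! ### The bi-degree sequence -/

/-- A pair (in-degree sequence, out-degree sequence) for the nodes `0, …, n - 1`. -/
abbrev BiDegree (n : ℕ) := (Fin n → ℕ) × (Fin n → ℕ)

/-- The discrepancy `∑ (𝒩 i - 𝒟 i)` of the two sampled sequences. -/
def disc {n : ℕ} (x : BiDegree n) : ℤ := ∑ i, ((x.1 i : ℤ) - (x.2 i : ℤ))

/-- The constant `min {1 - 1/α, 1 - 1/β, 1/2}`. -/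
def kappa (α β : ℝ) : ℝ := min (min (1 - α⁻¹) (1 - β⁻¹)) (1 / 2)

/-- The samples that are accepted: `|Δ| ≤ n ^ (1 - κ + δ₀)`. -/
def accept (α β δ₀ : ℝ) (n : ℕ) : Set (BiDegree n) :=
  {x | |(disc x : ℝ)| ≤ (n : ℝ) ^ (1 - kappa α β + δ₀)}

/-- The law of two independent i.i.d. samples, of in-degrees from `Fi` and of out-degrees from
`Fo`, resampled until the pair is accepted; that is, conditioned on acceptance. -/
def acceptedLaw (Fi Fo : Measure ℕ) (α β δ₀ : ℝ) (n : ℕ) : Measure (BiDegree n) :=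
  cond ((Measure.pi fun _ : Fin n => Fi).prod (Measure.pi fun _ : Fin n => Fo))
    (accept α β δ₀ n)

open Classical in
/-- Add one inbound stub (if `Δ < 0`) or one outbound stub (if `Δ ≥ 0`) to every node of `A`. -/
def adjust {n : ℕ} (x : BiDegree n) (A : Set (Fin n)) : BiDegree n :=
  (fun i => x.1 i + if disc x < 0 ∧ i ∈ A then 1 else 0,
   fun i => x.2 i + if 0 ≤ disc x ∧ i ∈ A then 1 else 0)

/-- The law of the bi-degree sequence: after acceptance, the sequence is adjusted at `|Δ|` nodes
chosen uniformly without replacement. -/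
def biDegreeLaw (Fi Fo : Measure ℕ) (α β δ₀ : ℝ) (n : ℕ) : Measure (BiDegree n) :=
  (acceptedLaw Fi Fo α β δ₀ n ⊗ₘ Kernel.ofFunOfCountable
    (fun x => uniformOn {A : Set (Fin n) | A.ncard = (disc x).natAbs})).map
      (fun y => adjust y.1 y.2)

/-! ### Random draws of outbound stubs -/

/-- The `b`-th outbound stub of node `j` is the pair `(j, b)`, where `b < D j`. -/
abbrev Stub (n : ℕ) := Fin n × ℕ

/-- The uniform distribution on the outbound stubs. If there are none, nothing is ever drawn and
the (irrelevant) value is a Dirac mass. -/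
def stubLaw {n : ℕ} (D : Fin n → ℕ) (root : Fin n) : Measure (Stub n) :=
  if 0 < ∑ i, D i then uniformOn {e : Stub n | e.2 < D e.1} else Measure.dirac (root, 0)

/-- All randomness of the model: the bi-degree sequence, the root, and an array of draws of
outbound stubs. The draw `(t, 0)` is the stub drawn for the `t`-th inbound stub (in breadth-first
order), and `(t, 1), (t, 2), …` are the redraws for it. -/
abbrev Sample (n : ℕ) := (BiDegree n × Fin n) × (ℕ × ℕ → Stub n)

/-- The law of the model: the bi-degree sequence is as above, the root is uniform and independent
of it, and given both the draws are independent and uniform on the outbound stubs. -/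
def law (Fi Fo : Measure ℕ) (α β δ₀ : ℝ) (n : ℕ) : Measure (Sample n) :=
  ((biDegreeLaw Fi Fo α β δ₀ n).prod (uniformOn (Set.univ : Set (Fin n)))) ⊗ₘ
    Kernel.ofFunOfCountable
      (fun y => Measure.infinitePi fun _ : ℕ × ℕ => stubLaw y.1.2 y.2)

/-! ### The graph -/

/-- The inbound stubs of the nodes in a list, in the order of the list; each of them is
represented by the node to which it belongs. -/
def inbound {n : ℕ} (N : Fin n → ℕ) (v : List (Fin n)) : List (Fin n) :=
  v.flatMap fun i => List.replicate (N i) i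

/-- The first stub in the sequence of draws `d` that is not already paired. -/
def firstUnpaired {n : ℕ} (p : List (Stub n)) (d : ℕ → Stub n) : Stub n :=
  d (sInf {m | d m ∉ p})

/-- The nodes `v`, or all nodes when the first `t` inbound stubs to be paired are all the inbound
stubs of `v` (so that no unpaired inbound stub is left in the explored part of the graph). -/
def extend {n : ℕ} (N : Fin n → ℕ) (t : ℕ) (v : List (Fin n)) : List (Fin n) :=
  if (inbound N v).length ≤ t then v ++ (List.finRange n).filter (fun i => i ∉ v) else v

/-- The exploration of the graph in breadth-first order, starting at the root, after `t` inbound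
stubs have been paired: the list of the nodes attached so far, in order of attachment, and the
list of the outbound stubs paired so far. The `t`-th inbound stub is paired with the first drawn
stub not yet paired; the owner of this stub is attached if it is new.

An outbound stub has label 1 if its node is not attached, label 3 if it is paired, and
label 2 otherwise. -/
def explore {n : ℕ} (N : Fin n → ℕ) (root : Fin n) (w : ℕ × ℕ → Stub n) :
    ℕ → List (Fin n) × List (Stub n)
  | 0 => ([root], [])
  | t + 1 =>
    let v := extend N t (explore N root w t).1
    let p := (explore N root w t).2
    let e := firstUnpaired p fun m => w (t, m)
    (if e.1 ∈ v then v else v ++ [e.1], p ++ [e])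

/-- The number of edges from `i` to `j` in the graph, once all inbound stubs are paired: the
`t`-th inbound stub is paired with the `t`-th stub in the list of paired outbound stubs. -/
def edges {n : ℕ} (N : Fin n → ℕ) (root : Fin n) (w : ℕ × ℕ → Stub n) (i j : Fin n) : ℕ :=
  let s := explore N root w (∑ i, N i)
  (s.2.zip (inbound N s.1)).countP fun x => x.1.1 = i ∧ x.2 = j

/-- The matrix with entries `s_ij * c / D_i` (zero if there is no edge from `i` to `j`). -/
def prMatrix {n : ℕ} (c : ℝ) (N D : Fin n → ℕ) (root : Fin n) (w : ℕ × ℕ → Stub n) :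
    Matrix (Fin n) (Fin n) ℝ :=
  Matrix.of fun i j => (edges N root w i j : ℝ) * c / (D i : ℝ)

/-- The solution `R` of `R = R M + (1 - c) 1`. -/
def pageRank {n : ℕ} (c : ℝ) (M : Matrix (Fin n) (Fin n) ℝ) : Fin n → ℝ :=
  Matrix.vecMul (fun _ => 1 - c) (1 - M)⁻¹

/-- If the absolute row sums of `M` are less than one, which is the case for the matrix of any
graph whose out-degrees are given by `D`, then `pageRank c M` is the unique solution. -/
theorem eq_pageRank_iff {n : ℕ} (c : ℝ) (M : Matrix (Fin n) (Fin n) ℝ)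
    (hM : ∀ i, ∑ j, |M i j| < 1) (R : Fin n → ℝ) :
    R = pageRank c M ↔ R = Matrix.vecMul R M + fun _ => 1 - c := by
  have hdet : IsUnit (1 - M).det := by
    refine isUnit_iff_ne_zero.mpr (det_ne_zero_of_sum_row_lt_diag (A := 1 - M) fun k => ?_)
    have h1 := hM k
    rw [← Finset.add_sum_erase _ _ (Finset.mem_univ k)] at h1
    have h2 : ∑ j ∈ Finset.univ.erase k, ‖(1 - M) k j‖ =
        ∑ j ∈ Finset.univ.erase k, |M k j| := by
      refine Finset.sum_congr rfl fun j hj => ?_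
      simp [Matrix.one_apply_ne (Finset.ne_of_mem_erase hj).symm]
    have h3 : (1 : ℝ) - |M k k| ≤ ‖(1 - M) k k‖ := by
      have := abs_sub_abs_le_abs_sub (1 : ℝ) (M k k)
      simpa using this
    rw [h2]
    linarith
  have key : R = Matrix.vecMul R M + (fun _ => 1 - c) ↔
      Matrix.vecMul R (1 - M) = fun _ => 1 - c := by
    rw [Matrix.vecMul_sub, Matrix.vecMul_one, sub_eq_iff_eq_add, add_comm]
  rw [key, pageRank]
  constructor
  · rintro rfl
    rw [Matrix.vecMul_vecMul, Matrix.nonsing_inv_mul _ hdet, Matrix.vecMul_one]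
  · intro h
    rw [← h, Matrix.vecMul_vecMul, Matrix.mul_nonsing_inv _ hdet, Matrix.vecMul_one]

/-! ### The thorny branching tree

The individuals of the tree are numbered in breadth-first order, the root being number `0`. The
individual `t + 1` is born from the draw for the `t`-th inbound stub in the tree. If the stub drawn
belongs to node `j`, the individual is a copy of `j`: it has `N j` offspring and `D j` outbound
stubs, of which one points to its parent and `D j - 1` point outside the tree. -/

/-- The node of which the individual is a copy. -/
def copyOf {n : ℕ} (root : Fin n) (w : ℕ × ℕ → Stub n) : ℕ → Fin n
  | 0 => root
  | t + 1 => (w (t, 0)).1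

/-- The number of the `a`-th child of individual `t`, for `a < N (copyOf root w t)`: it comes after
the root, the children of the individuals before `t`, and the first `a` children of `t`. -/
def child {n : ℕ} (N : Fin n → ℕ) (root : Fin n) (w : ℕ × ℕ → Stub n) (t a : ℕ) : ℕ :=
  1 + ∑ s ∈ Finset.range t, N (copyOf root w s) + a

/-- PageRank of an individual of the tree after `k` iterations, started at `r₀`. Every child passes
on to its parent `c` times its score divided by its number of outbound stubs. -/
def treeRank {n : ℕ} (c r₀ : ℝ) (N D : Fin n → ℕ) (root : Fin n) (w : ℕ × ℕ → Stub n) :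
    ℕ → ℕ → ℝ
  | 0, _ => r₀
  | k + 1, t => (1 - c) + ∑ a ∈ Finset.range (N (copyOf root w t)),
      c / (D (copyOf root w (child N root w t a)) : ℝ) *
        treeRank c r₀ N D root w k (child N root w t a)

/-! ### The two random variables -/

/-- The scale-free PageRank, in the graph, of the root. -/
def graphRoot {n : ℕ} (c : ℝ) (s : Sample n) : ℝ :=
  pageRank c (prMatrix c s.1.1.1 s.1.1.2 s.1.2 s.2) s.1.2

/-- PageRank, after `k` iterations, of the root of the coupled tree. -/
def treeRoot {n : ℕ} (c r₀ : ℝ) (k : ℕ) (s : Sample n) : ℝ :=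
  treeRank c r₀ s.1.1.1 s.1.1.2 s.1.2 s.2 k 0

end DCM

end

namespace DCM

open scoped ENNReal

/-! ### Moments from tail bounds -/

/-! Let R(k) denote k steps of the PageRank iteration on the graph (`powerRank`). The error splits
at R(k), and the two halves are controlled for different reasons.

From the fixed point to R(k): the matrix acts on row vectors and has row sums at most c, so each
step contracts the ℓ¹ norm by c, and the error summed over all nodes is at most n(r₀+1)c^k. A
uniform root and Markov's inequality would give the first term of the bound, except that the graph
is built by an exploration that starts at the root. Hence it must be shown that the law of the graph
is the same for every root: each ordering of the L outbound stubs is the pairing order with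
probability 1/L!, and for a fixed root the map from orderings to matchings of stubs is a bijection.
So the graph is that of a uniform matching (`drawLaw_edges_le`,
`sum_drawLaw_pageRank_sub_powerRank_le`).

From R(k) to the tree: if the individuals of the first k generations are copies of distinct nodes,
no redraw occurs among the draws that bear them, the exploration lists the same nodes as the tree,
and R(k) at the root equals the tree value exactly (`powerRank_root_eq_treeRank`). This can fail
only if the tree has more than m individuals, or if two of the first m coincide. Wald's identity
bounds the mean size, averaged over the root, by a constant times λ^k, where λ bounds the mean
in-degree of the owner of a random outbound stub (`sum_drawLaw_lt_treeSize_le`). Coincidences cost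
O(m²/n) when ∑D² = O(n) (`sum_drawLaw_not_injOn_le`). Since h < 1/(2 log μ), some λ > μ has λ^k ≤
n^a with a < 1/2 for all k ≤ h log n, and m slightly below √n makes both terms a negative power of n
(`exists_treeSize_bound`).

The degrees are good enough for this off an event of probability O(n^(-δ)): in- and out-degrees are
sampled independently, so E[𝒩𝒟]/E[𝒟] = μ < λ, and moments of order above one give a law of large
numbers with a polynomial rate (`exists_biDegreeLaw_not_goodDegrees_le`). Acceptance has probability
tending to one, so conditioning on it costs a factor 2. -/

theorem SlowlyVarying.exists_le_two_pow {L : ℝ → ℝ} (hL : SlowlyVarying L) {η : ℝ} (hη : 0 < η) :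
    ∃ C : ℝ, 0 < C ∧ ∀ j : ℕ, L (2 ^ j) ≤ C * ((2 : ℝ) ^ η) ^ j := by
  have hq : (1 : ℝ) < (2 : ℝ) ^ η := Real.one_lt_rpow (by norm_num) hη
  have h1 : ∀ᶠ x in atTop, L (2 * x) / L x < (2 : ℝ) ^ η :=
    (hL.tendsto 2 (by norm_num)).eventually_lt_const hq
  have h2 : ∀ᶠ j : ℕ in atTop, L (2 * 2 ^ j) / L (2 ^ j) < (2 : ℝ) ^ η :=
    (tendsto_pow_atTop_atTop_of_one_lt (by norm_num : (1 : ℝ) < 2)).eventually h1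
  obtain ⟨J, hJ⟩ := eventually_atTop.1 h2
  have hpos : ∀ j : ℕ, 0 < L (2 ^ j) := fun j => hL.pos _ (by positivity)
  -- From 2^J on, doubling the argument costs at most a factor 2^η; this sum dominates each of the
  -- finitely many values up to there.
  refine ⟨∑ i ∈ Finset.range (J + 1), L (2 ^ i),
    Finset.sum_pos (fun i _ => hpos i) (by simp), fun j => ?_⟩
  have hC : 0 < ∑ i ∈ Finset.range (J + 1), L (2 ^ i) :=
    Finset.sum_pos (fun i _ => hpos i) (by simp)
  induction j with
  | zero =>
    simpa using Finset.single_le_sum (f := fun i => L (2 ^ i)) (fun i _ => (hpos i).le)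
      (Finset.mem_range.2 (Nat.succ_pos J))
  | succ j ih =>
    by_cases hj : J ≤ j
    · have h3 := hJ j hj
      rw [div_lt_iff₀ (hpos j)] at h3
      calc L (2 ^ (j + 1)) = L (2 * 2 ^ j) := by rw [pow_succ']
        _ ≤ (2 : ℝ) ^ η * L (2 ^ j) := h3.le
        _ ≤ (2 : ℝ) ^ η * ((∑ i ∈ Finset.range (J + 1), L (2 ^ i)) * ((2 : ℝ) ^ η) ^ j) := by
          gcongr
        _ = _ := by ring
    · have h4 : L (2 ^ (j + 1)) ≤ ∑ i ∈ Finset.range (J + 1), L (2 ^ i) :=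
        Finset.single_le_sum (f := fun i => L (2 ^ i)) (fun i _ => (hpos i).le)
          (Finset.mem_range.2 (by omega))
      exact h4.trans (le_mul_of_one_le_right hC.le (one_le_pow₀ hq.le))

/-- Dyadic decomposition: the block (2^j, 2^(j+1)] contributes about 2^(j(p-a)) L(2^j). Half of the
gap a - p absorbs the growth of L, and the rest leaves a geometric series of ratio q < 1. -/
theorem TailBound.integrable_rpow {F : Measure ℕ} [IsProbabilityMeasure F] {a p : ℝ}
    (hF : TailBound F a) (hp : 0 < p) (hpa : p < a) :
    Integrable (fun k : ℕ => (k : ℝ) ^ p) F := by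
  obtain ⟨L, hL, hT⟩ := hF
  obtain ⟨C, hC, hLC⟩ := hL.exists_le_two_pow (η := (a - p) / 2) (by linarith)
  set q : ℝ := (2 : ℝ) ^ p * (2 : ℝ) ^ (-a) * (2 : ℝ) ^ ((a - p) / 2) with hq
  have hq0 : 0 < q := by positivity
  have hq1 : q < 1 := by
    rw [hq, ← Real.rpow_add (by norm_num), ← Real.rpow_add (by norm_num)]
    exact Real.rpow_lt_one_of_one_lt_of_neg (by norm_num) (by linarith)
  have hmeas : ∀ s : Set ℕ, MeasurableSet s := fun s => MeasurableSet.of_discrete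
  refine ⟨(measurable_of_countable _).aestronglyMeasurable, ?_⟩
  have hpt : ∀ k : ℕ, ‖(k : ℝ) ^ p‖ₑ ≤ 1 + ∑' j : ℕ,
      ENNReal.ofReal (((2 : ℝ) ^ p) ^ (j + 1)) * {k : ℕ | (2 : ℝ) ^ j < k}.indicator 1 k := by
    intro k
    rw [Real.enorm_of_nonneg (by positivity)]
    rcases Nat.lt_or_ge k 2 with hk | hk
    · refine le_trans ?_ le_self_add
      rw [ENNReal.ofReal_le_one]
      exact Real.rpow_le_one (by positivity) (by exact_mod_cast (by omega : k ≤ 1)) hp.le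
    · refine le_trans ?_ le_add_self
      -- The shift by one yields 2^j < k ≤ 2^(j+1), with the strict inequality that the tail events
      -- require.
      set j := Nat.log 2 (k - 1) with hj
      have h1 : 2 ^ j ≤ k - 1 := Nat.pow_log_le_self 2 (by omega)
      have h2 : k - 1 < 2 ^ (j + 1) := Nat.lt_pow_succ_log_self (by norm_num) _
      refine le_trans ?_ (ENNReal.le_tsum j)
      have h3 : (2 : ℝ) ^ j < k := by
        have : 2 ^ j < k := by omega
        exact_mod_cast this
      have h4 : (k : ℝ) ≤ 2 ^ (j + 1) := by
        have : k ≤ 2 ^ (j + 1) := by omega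
        exact_mod_cast this
      rw [Set.indicator_of_mem (by exact h3), Pi.one_apply, mul_one]
      apply ENNReal.ofReal_le_ofReal
      calc (k : ℝ) ^ p ≤ ((2 : ℝ) ^ (j + 1)) ^ p := by gcongr
        _ = _ := by rw [← Real.rpow_natCast, ← Real.rpow_natCast, ← Real.rpow_mul (by norm_num),
          ← Real.rpow_mul (by norm_num), mul_comm]
  have hterm : ∀ j : ℕ, ENNReal.ofReal (((2 : ℝ) ^ p) ^ (j + 1)) * F {k : ℕ | (2 : ℝ) ^ j < k} ≤
      ENNReal.ofReal (((2 : ℝ) ^ p * C) * q ^ j) := by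
    intro j
    rw [← ofReal_measureReal, ← ENNReal.ofReal_mul (by positivity)]
    apply ENNReal.ofReal_le_ofReal
    have h5 : F.real {k : ℕ | (2 : ℝ) ^ j < k} ≤
        ((2 : ℝ) ^ (-a)) ^ j * (C * ((2 : ℝ) ^ ((a - p) / 2)) ^ j) := by
      refine (hT _ (by positivity)).trans ?_
      have : ((2 : ℝ) ^ j) ^ (-a) = ((2 : ℝ) ^ (-a)) ^ j := by
        rw [← Real.rpow_natCast, ← Real.rpow_natCast, ← Real.rpow_mul (by norm_num),
          ← Real.rpow_mul (by norm_num), mul_comm]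
      rw [this]
      gcongr
      exact hLC j
    calc _ ≤ ((2 : ℝ) ^ p) ^ (j + 1) *
          (((2 : ℝ) ^ (-a)) ^ j * (C * ((2 : ℝ) ^ ((a - p) / 2)) ^ j)) := by gcongr
      _ = _ := by rw [hq, mul_pow, mul_pow]; ring
  calc ∫⁻ k, ‖(k : ℝ) ^ p‖ₑ ∂F ≤ ∫⁻ k, (1 + ∑' j : ℕ,
      ENNReal.ofReal (((2 : ℝ) ^ p) ^ (j + 1)) * {k : ℕ | (2 : ℝ) ^ j < k}.indicator 1 k) ∂F :=
        lintegral_mono hpt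
    _ = 1 + ∑' j : ℕ, ENNReal.ofReal (((2 : ℝ) ^ p) ^ (j + 1)) * F {k : ℕ | (2 : ℝ) ^ j < k} := by
      rw [lintegral_add_left (by fun_prop), lintegral_tsum (fun _ => (measurable_of_countable _).aemeasurable)]
      simp only [lintegral_one, measure_univ]
      congr 2
      ext j
      rw [lintegral_const_mul _ (measurable_of_countable _), lintegral_indicator_one (hmeas _)]
    _ ≤ 1 + ∑' j : ℕ, ENNReal.ofReal (((2 : ℝ) ^ p * C) * q ^ j) := by
      gcongr with j
      exact hterm j
    _ < ⊤ := by
      rw [← ENNReal.ofReal_tsum_of_nonneg (fun j => by positivity)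
        ((summable_geometric_of_lt_one hq0.le hq1).mul_left _)]
      exact ENNReal.add_lt_top.2 ⟨ENNReal.one_lt_top, ENNReal.ofReal_lt_top⟩

/-! ### Deviations of sums of independent copies -/

/-- Truncate f at level t. The p-th moment controls the probability that some summand is truncated,
the variance of the truncated summands and, because f is centred, their mean. The constant is 1 from
the union bound plus 4 from Chebyshev's inequality at t/2. -/
theorem measureReal_pi_abs_sum_le {Ω : Type*} [MeasurableSpace Ω] (ν : Measure Ω)
    [IsProbabilityMeasure ν] {f : Ω → ℝ} (hf : Measurable f) {p : ℝ} (hp1 : 1 ≤ p) (hp2 : p ≤ 2)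
    (hi : Integrable f ν) (h0 : ∫ ω, f ω ∂ν = 0) (hp : Integrable (fun ω => |f ω| ^ p) ν)
    (n : ℕ) {t : ℝ} (ht : 0 < t) :
    (Measure.pi fun _ : Fin n => ν).real {y | t < |∑ i, f (y i)|} ≤
      5 * (∫ ω, |f ω| ^ p ∂ν) * n * t ^ (-p) := by
  set M := ∫ ω, |f ω| ^ p ∂ν with hM
  have hM0 : 0 ≤ M := integral_nonneg fun ω => by positivity
  set u := t ^ (-p) with hu
  have hu0 : 0 < u := by positivity
  have htail : ∀ ω, t < |f ω| → 1 ≤ u * |f ω| ^ p := by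
    intro ω h
    rw [hu, Real.rpow_neg ht.le, inv_mul_eq_div, one_le_div (by positivity)]
    exact Real.rpow_le_rpow ht.le h.le (by linarith)
  set g : Ω → ℝ := fun ω => if |f ω| ≤ t then f ω else 0 with hg
  have hgm : Measurable g := Measurable.ite (measurableSet_le (by fun_prop) (by fun_prop)) hf
    measurable_const
  have hgb : ∀ ω, |g ω| ≤ t := by
    intro ω
    simp only [hg]
    split_ifs with h
    · exact h
    · simpa using ht.le
  have hg2 : MemLp g 2 ν := MemLp.of_bound hgm.aestronglyMeasurable t
    (Eventually.of_forall fun ω => by simpa using hgb ω)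
  have hmean : |∫ ω, g ω ∂ν| ≤ t * u * M := by
    have e1 : ∫ ω, g ω ∂ν = - ∫ ω, (f ω - g ω) ∂ν := by
      rw [integral_sub hi (hg2.integrable (by norm_num)), h0]; ring
    rw [e1, abs_neg, hM, ← integral_const_mul]
    refine (abs_integral_le_integral_abs).trans
      (integral_mono (hi.sub (hg2.integrable (by norm_num))).abs (hp.const_mul _) fun ω => ?_)
    simp only [hg]
    split_ifs with h
    · simp only [sub_self, abs_zero]; positivity
    · push Not at h
      have h2 : |f ω| = |f ω| ^ (1 - p) * |f ω| ^ p := by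
        rw [← Real.rpow_add (ht.trans h)]; simp
      have h3 : |f ω| ^ (1 - p) ≤ t ^ (1 - p) :=
        Real.rpow_le_rpow_of_nonpos ht h.le (by linarith)
      have h4 : t ^ (1 - p) = t * u := by
        rw [sub_eq_add_neg, Real.rpow_add ht, Real.rpow_one]
      rw [sub_zero]
      calc |f ω| = |f ω| ^ (1 - p) * |f ω| ^ p := h2
        _ ≤ t ^ (1 - p) * |f ω| ^ p := by gcongr
        _ = _ := by rw [h4]
  have hvar : Var[g; ν] ≤ t ^ 2 * u * M := by
    refine (variance_le_expectation_sq hgm.aestronglyMeasurable).trans ?_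
    rw [hM, ← integral_const_mul]
    refine integral_mono (hg2.integrable_sq) (hp.const_mul _) fun ω => ?_
    simp only [hg, Pi.pow_apply]
    split_ifs with h
    · rcases eq_or_ne (f ω) 0 with h1 | h1
      · rw [h1]; simp only [ne_eq, OfNat.ofNat_ne_zero, not_false_eq_true, zero_pow]; positivity
      have h1' : 0 < |f ω| := abs_pos.2 h1
      have h2 : (f ω) ^ 2 = |f ω| ^ (2 - p) * |f ω| ^ p := by
        rw [← Real.rpow_add h1', ← sq_abs]; simp
      have h4 : t ^ (2 - p) = t ^ 2 * u := by
        rw [sub_eq_add_neg, Real.rpow_add ht, Real.rpow_two]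
      rw [h2, ← h4]
      gcongr
    · simp only [ne_eq, OfNat.ofNat_ne_zero, not_false_eq_true, zero_pow]; positivity
  set P := Measure.pi fun _ : Fin n => ν with hP
  -- If the bound on the truncated mean, times n, exceeds t/2, then the right-hand side of the claim
  -- exceeds 5/2 and there is nothing to prove.
  by_cases hbig : n * (t * u * M) ≤ t / 2
  swap
  · push Not at hbig
    refine measureReal_le_one.trans ?_
    have : 1 / 2 < n * (u * M) := by
      rw [← mul_lt_mul_iff_right₀ ht]
      linarith [hbig]
    nlinarith
  have hS2 : MemLp (∑ i : Fin n, fun y : Fin n → Ω => g (y i)) 2 P :=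
    memLp_finsetSum' _ fun i _ => hg2.comp_measurePreserving (measurePreserving_eval _ i)
  have hSmean : ∫ y, (∑ i : Fin n, fun y : Fin n → Ω => g (y i)) y ∂P = n * ∫ ω, g ω ∂ν := by
    simp only [Finset.sum_apply]
    rw [integral_finsetSum]
    · have : ∀ i : Fin n, ∫ y, g (y i) ∂P = ∫ ω, g ω ∂ν := fun i => by
        have h := (measurePreserving_eval (fun _ : Fin n => ν) i).map_eq
        rw [← h, integral_map (measurePreserving_eval (fun _ : Fin n => ν) i).measurable.aemeasurable
          (by rw [h]; exact hgm.aestronglyMeasurable)]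
      simp [this]
    · intro i _
      exact (hg2.comp_measurePreserving (measurePreserving_eval _ i)).integrable (by norm_num)
  have hcheb := meas_ge_le_variance_div_sq hS2 (c := t / 2) (by positivity)
  rw [variance_sum_pi (fun _ => hg2), hSmean] at hcheb
  have hcheb' : P.real {y | t / 2 ≤ |(∑ i : Fin n, fun y : Fin n → Ω => g (y i)) y -
      n * ∫ ω, g ω ∂ν|} ≤ 4 * n * (u * M) := by
    refine ENNReal.toReal_le_of_le_ofReal (by positivity) (hcheb.trans ?_)
    apply ENNReal.ofReal_le_ofReal
    rw [div_le_iff₀ (by positivity)]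
    simp only [Finset.sum_const, Finset.card_univ, Fintype.card_fin, nsmul_eq_mul]
    calc n * Var[g; ν] ≤ n * (t ^ 2 * u * M) := by gcongr
      _ = _ := by ring
  have htl : ∀ i : Fin n, P.real {y | t < |f (y i)|} ≤ u * M := by
    intro i
    have h := (measurePreserving_eval (fun _ : Fin n => ν) i).measureReal_preimage
      (s := {ω | t < |f ω|}) (measurableSet_lt (by fun_prop) (by fun_prop)).nullMeasurableSet
    have h' : P.real {y | t < |f (y i)|} = ν.real {ω | t < |f ω|} := h
    rw [h', hM, ← integral_const_mul, ← integral_indicator_one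
      (measurableSet_lt (by fun_prop) (by fun_prop))]
    refine integral_mono ((integrable_const (1 : ℝ)).indicator
      (measurableSet_lt (by fun_prop) (by fun_prop))) (hp.const_mul _) fun ω => ?_
    by_cases hω : t < |f ω|
    · rw [Set.indicator_of_mem (by exact hω)]; exact htail ω hω
    · rw [Set.indicator_of_notMem (by exact hω)]; positivity
  calc P.real {y | t < |∑ i, f (y i)|}
      ≤ P.real ((⋃ i : Fin n, {y | t < |f (y i)|}) ∪
        {y | t / 2 ≤ |(∑ i : Fin n, fun y : Fin n → Ω => g (y i)) y - n * ∫ ω, g ω ∂ν|}) := by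
        refine measureReal_mono (fun y hy => ?_) (measure_ne_top _ _)
        by_cases hex : ∃ i, t < |f (y i)|
        · left; simpa using hex
        · right
          push Not at hex
          simp only [Set.mem_ofPred_eq, Finset.sum_apply] at hy ⊢
          have : ∀ i, g (y i) = f (y i) := fun i => if_pos (hex i)
          simp only [this]
          have h1 : |n * ∫ ω, g ω ∂ν| ≤ t / 2 := by
            rw [abs_mul, Nat.abs_cast]
            refine le_trans ?_ hbig
            gcongr
          have := abs_sub_abs_le_abs_sub (∑ i, f (y i)) (n * ∫ ω, g ω ∂ν)
          linarith
    _ ≤ n * (u * M) + 4 * n * (u * M) := by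
        refine (measureReal_union_le _ _).trans (add_le_add ?_ hcheb')
        refine (measureReal_iUnion_fintype_le _).trans ?_
        refine (Finset.sum_le_sum fun i _ => htl i).trans ?_
        simp
    _ = _ := by ring

theorem exists_measureReal_pi_abs_sum_sub_le {Ω : Type*} [MeasurableSpace Ω] (ν : Measure Ω)
    [IsProbabilityMeasure ν] {f : Ω → ℝ} (hf : Measurable f) {p : ℝ} (hp1 : 1 ≤ p) (hp2 : p ≤ 2)
    (hp : MemLp f (ENNReal.ofReal p) ν) :
    ∃ C : ℝ, 0 ≤ C ∧ ∀ (n : ℕ) (t : ℝ), 0 < t →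
      (Measure.pi fun _ : Fin n => ν).real {y | t < |∑ i, f (y i) - n * ∫ ω, f ω ∂ν|} ≤
        C * n * t ^ (-p) := by
  set m := ∫ ω, f ω ∂ν with hm
  have hq1 : 1 ≤ ENNReal.ofReal p := by simpa using hp1
  have hg : MemLp (fun ω => f ω - m) (ENNReal.ofReal p) ν := hp.sub (memLp_const m)
  have hi : Integrable (fun ω => f ω - m) ν := hg.integrable hq1
  have hgp : Integrable (fun ω => |f ω - m| ^ p) ν := by
    have := hg.integrable_norm_rpow (by positivity) ENNReal.ofReal_ne_top
    rwa [ENNReal.toReal_ofReal (by linarith)] at this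
  refine ⟨5 * ∫ ω, |f ω - m| ^ p ∂ν, mul_nonneg (by norm_num) (integral_nonneg fun ω => by positivity), fun n t ht => ?_⟩
  have h := measureReal_pi_abs_sum_le ν (f := fun ω => f ω - m) (by fun_prop) hp1 hp2 hi
    (by rw [integral_sub (hp.integrable hq1) (integrable_const _)]; simp [hm]) hgp n ht
  simpa using h

/-- At a deviation of order n the moment bound reads n · n^(-p), so any moment of order above one
gives a polynomial rate. The order is cut off at 2, where the variance argument stops. -/
theorem exists_measureReal_pi_lt_le_rpow {Ω : Type*} [MeasurableSpace Ω] (ν : Measure Ω)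
    [IsProbabilityMeasure ν] {f : Ω → ℝ} (hf : Measurable f) {p : ℝ} (hp1 : 1 < p)
    (hp : MemLp f (ENNReal.ofReal p) ν) {η : ℝ} (hη : 0 < η) :
    ∃ δ : ℝ, 0 < δ ∧ ∃ C : ℝ, ∀ n : ℕ, 1 ≤ n →
      (Measure.pi fun _ : Fin n => ν).real {y | η * n < |∑ i, f (y i) - n * ∫ ω, f ω ∂ν|} ≤
        C * (n : ℝ) ^ (-δ) := by
  have hp' : MemLp f (ENNReal.ofReal (min p 2)) ν :=
    hp.mono_exponent (ENNReal.ofReal_le_ofReal (min_le_left _ _))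
  obtain ⟨C, hC, h⟩ := exists_measureReal_pi_abs_sum_sub_le ν hf
    (le_min hp1.le (by norm_num)) (min_le_right _ _) hp'
  have h1 : 1 < min p 2 := lt_min hp1 (by norm_num)
  refine ⟨min p 2 - 1, by linarith, C * η ^ (-min p 2), fun n hn => ?_⟩
  have hn' : (0 : ℝ) < n := by exact_mod_cast hn
  refine (h n (η * n) (by positivity)).trans (le_of_eq ?_)
  rw [Real.mul_rpow hη.le hn'.le, show -(min p 2 - 1) = 1 + -min p 2 by ring, Real.rpow_add hn',
    Real.rpow_one]
  ring

/-! ### Bi-degree sequences -/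

/-- A bi-degree sequence with equal sums, at least `n` stubs of each direction, bounded empirical
second moment of the out-degrees and bounded size-biased mean of the in-degrees. -/
structure GoodDegrees {n : ℕ} (lam b : ℝ) (x : BiDegree n) : Prop where
  sum_eq : ∑ i, x.1 i = ∑ i, x.2 i
  sum_mul_le : ∑ i, (x.1 i : ℝ) * x.2 i ≤ lam * ∑ i, (x.2 i : ℝ)
  le_sum : (n : ℝ) ≤ ∑ i, (x.2 i : ℝ)
  sum_sq_le : ∑ i, (x.2 i : ℝ) ^ 2 ≤ b * n

/-- The law of the two independent i.i.d. samples before conditioning. -/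
noncomputable abbrev sampleLaw (Fi Fo : Measure ℕ) (n : ℕ) : Measure (BiDegree n) :=
  (Measure.pi fun _ : Fin n => Fi).prod (Measure.pi fun _ : Fin n => Fo)

/-- The product of the degrees plus the part of their sum that exceeds `K`. -/
noncomputable def truncProd (K : ℝ) (y : ℕ × ℕ) : ℝ :=
  (y.1 : ℝ) * y.2 + max ((y.1 : ℝ) + y.2 - K) 0

/-! ### The effect of the added stubs on the degree sums. -/

section Adjust

variable {n : ℕ} (x : BiDegree n) (A : Set (Fin n))

open Classical in
theorem sum_ite_mem_eq_ncard : ∑ i, (if i ∈ A then 1 else 0 : ℕ) = A.ncard := by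
  rw [Finset.sum_boole, Set.ncard_eq_toFinset_card']
  simp only [Nat.cast_id]
  congr 1
  ext i
  simp

theorem sum_adjust_eq (hA : A.ncard = (disc x).natAbs) :
    ∑ i, (adjust x A).1 i = ∑ i, (adjust x A).2 i := by
  classical
  have hd : disc x = ∑ i, (x.1 i : ℤ) - ∑ i, (x.2 i : ℤ) := by
    simp [disc, Finset.sum_sub_distrib]
  have hs := sum_ite_mem_eq_ncard A
  simp only [adjust, Finset.sum_add_distrib]
  by_cases h : disc x < 0
  · have h' : ¬ 0 ≤ disc x := by omega
    simp only [h, h', true_and, false_and, if_false]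
    rw [Finset.sum_const_zero]
    zify at hs hA ⊢
    rw [abs_of_neg h] at hA
    omega
  · have h' : 0 ≤ disc x := by omega
    simp only [h, h', true_and, false_and, if_false]
    rw [Finset.sum_const_zero]
    zify at hs hA ⊢
    rw [abs_of_nonneg h'] at hA
    omega

/-- An added stub raises the product of the degrees by one of the two degrees, hence by at most K
plus the excess of their sum over K. Charging the excess to all nodes makes the first sum i.i.d. and
the bound uniform over sets A of a given size. -/
theorem sum_adjust_mul_le (K : ℝ) :
    ∑ i, ((adjust x A).1 i : ℝ) * (adjust x A).2 i ≤
      ∑ i, truncProd K (x.1 i, x.2 i) + K * A.ncard := by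
  classical
  rw [← sum_ite_mem_eq_ncard A, Nat.cast_sum, Finset.mul_sum, ← Finset.sum_add_distrib]
  refine Finset.sum_le_sum fun i _ => ?_
  have h1 := le_max_left ((x.1 i : ℝ) + x.2 i - K) 0
  have h2 := le_max_right ((x.1 i : ℝ) + x.2 i - K) 0
  have h3 : (0 : ℝ) ≤ x.1 i := by positivity
  have h4 : (0 : ℝ) ≤ x.2 i := by positivity
  simp only [adjust, truncProd]
  by_cases hi : i ∈ A <;> by_cases hd : disc x < 0
  · have hd' : ¬ 0 ≤ disc x := by omega
    simp only [hi, hd, hd', and_self, and_true, if_true, if_false]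
    push_cast
    nlinarith
  · have hd' : 0 ≤ disc x := by omega
    simp only [hi, hd, hd', and_self, and_true, if_true, if_false]
    push_cast
    nlinarith
  · simp only [hi, and_false, if_false]
    push_cast
    nlinarith
  · simp only [hi, and_false, if_false]
    push_cast
    nlinarith

theorem le_sum_adjust : ∑ i, (x.2 i : ℝ) ≤ ∑ i, ((adjust x A).2 i : ℝ) := by
  refine Finset.sum_le_sum fun i _ => ?_
  simp only [adjust]
  exact_mod_cast Nat.le_add_right _ _

theorem sum_adjust_sq_le :
    ∑ i, ((adjust x A).2 i : ℝ) ^ 2 ≤ 2 * ∑ i, (x.2 i : ℝ) ^ 2 + 2 * n := by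
  have : (2 : ℝ) * n = ∑ i : Fin n, (2 : ℝ) := by simp [mul_comm]
  rw [this, Finset.mul_sum, ← Finset.sum_add_distrib]
  refine Finset.sum_le_sum fun i _ => ?_
  simp only [adjust]
  split_ifs
  · push_cast
    nlinarith [sq_nonneg ((x.2 i : ℝ) - 1)]
  · push_cast
    nlinarith [sq_nonneg (x.2 i : ℝ)]

end Adjust

/-! ### Moments and deviations for the unconditioned samples. -/

section Moments

theorem memLp_fst_mul_snd {F G : Measure ℕ} {p : ℝ} (hp : 0 < p)
    (hF : MemLp (fun k : ℕ => (k : ℝ)) (ENNReal.ofReal p) F)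
    (hG : MemLp (fun k : ℕ => (k : ℝ)) (ENNReal.ofReal p) G) :
    MemLp (fun y : ℕ × ℕ => (y.1 : ℝ) * y.2) (ENNReal.ofReal p) (F.prod G) := by
  have h0 : ENNReal.ofReal p ≠ 0 := by simpa using hp
  rw [← integrable_norm_rpow_iff (measurable_of_countable _).aestronglyMeasurable h0
    ENNReal.ofReal_ne_top, ENNReal.toReal_ofReal hp.le] at hF hG ⊢
  refine (hF.mul_prod hG).congr (Eventually.of_forall fun y => ?_)
  simp only [norm_mul]
  rw [Real.mul_rpow (by positivity) (by positivity)]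

variable {F G : Measure ℕ} [IsProbabilityMeasure F] [IsProbabilityMeasure G]

theorem TailBound.memLp {a p : ℝ} (hF : TailBound F a) (hp : 0 < p) (hpa : p < a) :
    MemLp (fun k : ℕ => (k : ℝ)) (ENNReal.ofReal p) F := by
  rw [← integrable_norm_rpow_iff (measurable_of_countable _).aestronglyMeasurable (by simpa using hp)
    ENNReal.ofReal_ne_top, ENNReal.toReal_ofReal hp.le]
  simpa using hF.integrable_rpow hp hpa

theorem memLp_truncProd {p : ℝ} (hp : 0 < p)
    (hF : MemLp (fun k : ℕ => (k : ℝ)) (ENNReal.ofReal p) F)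
    (hG : MemLp (fun k : ℕ => (k : ℝ)) (ENNReal.ofReal p) G) {K : ℝ} (hK : 0 ≤ K) :
    MemLp (truncProd K) (ENNReal.ofReal p) (F.prod G) := by
  refine (memLp_fst_mul_snd hp hF hG).add ?_
  refine MemLp.mono ((hF.comp_fst G).add (hG.comp_snd F))
    (measurable_of_countable _).aestronglyMeasurable (Eventually.of_forall fun y => ?_)
  simp only [Pi.add_apply, Real.norm_eq_abs]
  rw [abs_of_nonneg (le_max_right _ _), abs_of_nonneg (by positivity)]
  exact max_le (by linarith) (by positivity)

/-- The excess over K vanishes pointwise for large K and is dominated by the sum of the degrees;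
what remains factorizes by independence. -/
theorem tendsto_integral_truncProd (hF : Integrable (fun k : ℕ => (k : ℝ)) F)
    (hG : Integrable (fun k : ℕ => (k : ℝ)) G) :
    Tendsto (fun K : ℕ => ∫ y, truncProd K y ∂F.prod G) atTop
      (𝓝 ((∫ k, (k : ℝ) ∂F) * ∫ k, (k : ℝ) ∂G)) := by
  rw [← integral_prod_mul]
  have h1 : Integrable (fun y : ℕ × ℕ => (y.1 : ℝ) * y.2) (F.prod G) := hF.mul_prod hG
  have h2 : Integrable (fun y : ℕ × ℕ => (y.1 : ℝ) + y.2) (F.prod G) :=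
    (hF.comp_fst G).add (hG.comp_snd F)
  refine tendsto_integral_of_dominated_convergence
    (fun y : ℕ × ℕ => (y.1 : ℝ) * y.2 + ((y.1 : ℝ) + y.2))
    (fun K => (measurable_of_countable _).aestronglyMeasurable) (h1.add h2) (fun K =>
      Eventually.of_forall fun y => ?_) (Eventually.of_forall fun y => ?_)
  · have : max ((y.1 : ℝ) + y.2 - K) 0 ≤ (y.1 : ℝ) + y.2 :=
      max_le (by linarith [(Nat.cast_nonneg K : (0 : ℝ) ≤ K)]) (by positivity)
    rw [truncProd, Real.norm_eq_abs, abs_of_nonneg (by positivity)]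
    gcongr
  · refine tendsto_const_nhds.congr' ?_
    filter_upwards [eventually_ge_atTop (y.1 + y.2)] with K hK
    have : ((y.1 + y.2 : ℕ) : ℝ) ≤ K := by exact_mod_cast hK
    push_cast at this
    rw [truncProd, max_eq_right (by linarith), add_zero]

/-- Regroups two independent sequences as one sequence of i.i.d. pairs, to which the deviation
bounds apply. -/
theorem measureReal_sampleLaw_eq (n : ℕ) (S : Set (Fin n → ℕ × ℕ)) :
    (sampleLaw F G n).real {x | (fun i => (x.1 i, x.2 i)) ∈ S} =
      (Measure.pi fun _ : Fin n => F.prod G).real S := by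
  have h := measurePreserving_arrowProdEquivProdArrow ℕ ℕ (Fin n) (fun _ => F) (fun _ => G)
  have h2 := h.measureReal_preimage (s := {x | (fun i => (x.1 i, x.2 i)) ∈ S})
    MeasurableSet.of_discrete.nullMeasurableSet
  rw [sampleLaw, ← h2]
  rfl

theorem exists_sampleLaw_deviation_le {f : ℕ × ℕ → ℝ} {p : ℝ} (hp1 : 1 < p)
    (hp : MemLp f (ENNReal.ofReal p) (F.prod G)) {η : ℝ} (hη : 0 < η) :
    ∃ δ : ℝ, 0 < δ ∧ ∃ C : ℝ, ∀ n : ℕ, 1 ≤ n →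
      (sampleLaw F G n).real
        {x | η * n < |∑ i, f (x.1 i, x.2 i) - n * ∫ y, f y ∂F.prod G|} ≤ C * (n : ℝ) ^ (-δ) := by
  obtain ⟨δ, hδ, C, h⟩ := exists_measureReal_pi_lt_le_rpow (F.prod G)
    (measurable_of_countable f) hp1 hp hη
  refine ⟨δ, hδ, C, fun n hn => ?_⟩
  have h' := h n hn
  rw [← measureReal_sampleLaw_eq] at h'
  exact h'

/-- The discrepancy is small with probability tending to one. -/
theorem tendsto_sampleLaw_accept {α β δ₀ : ℝ} (hα : 1 < α) (hβ : 2 < β)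
    (hF : TailBound F α) (hG : TailBound G β) (hm : ∫ k, (k : ℝ) ∂F = ∫ k, (k : ℝ) ∂G)
    (hδ₀ : 0 < δ₀) (hδ₀' : δ₀ < kappa α β) :
    Tendsto (fun n => (sampleLaw F G n).real (accept α β δ₀ n)) atTop (𝓝 1) := by
  set θ := 1 - kappa α β + δ₀ with hθ
  have hk1 : kappa α β ≤ 1 - α⁻¹ := (min_le_left _ _).trans (min_le_left _ _)
  have hk3 : kappa α β ≤ 1 / 2 := min_le_right _ _
  have hθ0 : 0 < θ := by linarith
  -- The exponent θ exceeds both 1/α and 1/2, so there is an order p < min(α, 2) with pθ > 1; then n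
  -- · n^(-pθ) tends to zero.
  have h1 : 1 / θ < min α 2 := by
    refine lt_min ?_ ?_
    · rw [div_lt_iff₀ hθ0]
      have : α⁻¹ < θ := by linarith
      calc (1 : ℝ) = α * α⁻¹ := by field_simp
        _ < α * θ := by gcongr
    · rw [div_lt_iff₀ hθ0]; linarith
  obtain ⟨p, hp1, hp2⟩ := exists_between h1
  have hpα : p < α := hp2.trans_le (min_le_left _ _)
  have hp2' : p < 2 := hp2.trans_le (min_le_right _ _)
  have hpθ : 1 < p * θ := by rwa [div_lt_iff₀ hθ0] at hp1
  have hθ1 : θ < 1 := by linarith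
  have hp : 1 < p := by nlinarith
  have hFp := hF.memLp (by linarith) hpα
  have hGp := hG.memLp (p := p) (by linarith) (by linarith)
  have hFi : Integrable (fun k : ℕ => (k : ℝ)) F := hFp.integrable (by simpa using hp.le)
  have hGi : Integrable (fun k : ℕ => (k : ℝ)) G := hGp.integrable (by simpa using hp.le)
  have hf : MemLp (fun y : ℕ × ℕ => (y.1 : ℝ) - y.2) (ENNReal.ofReal p) (F.prod G) :=
    (hFp.comp_fst G).sub (hGp.comp_snd F)
  obtain ⟨C, hC, h⟩ := exists_measureReal_pi_abs_sum_sub_le (F.prod G)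
    (measurable_of_countable _) hp.le hp2'.le hf
  have h0 : ∫ y : ℕ × ℕ, ((y.1 : ℝ) - y.2) ∂F.prod G = 0 := by
    rw [integral_sub (hFi.comp_fst G) (hGi.comp_snd F), integral_fun_fst (fun k : ℕ => (k : ℝ)),
      integral_fun_snd (fun k : ℕ => (k : ℝ))]
    simp [hm]
  have hlow : ∀ᶠ n : ℕ in atTop, 1 - C * (n : ℝ) ^ (1 - p * θ) ≤
      (sampleLaw F G n).real (accept α β δ₀ n) := by
    filter_upwards [eventually_ge_atTop 1] with n hn
    have hn' : (0 : ℝ) < n := by exact_mod_cast hn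
    have h3 := h n ((n : ℝ) ^ θ) (by positivity)
    rw [h0, ← measureReal_sampleLaw_eq] at h3
    have h4 : {x : BiDegree n | (fun i => (x.1 i, x.2 i)) ∈ {y : Fin n → ℕ × ℕ |
        (n : ℝ) ^ θ < |∑ i, (((y i).1 : ℝ) - (y i).2) - n * 0|}} = (accept α β δ₀ n)ᶜ := by
      ext x
      simp [accept, disc, hθ]
    rw [h4, probReal_compl_eq_one_sub MeasurableSet.of_discrete, ← Real.rpow_mul hn'.le] at h3
    have h5 : C * n * (n : ℝ) ^ (θ * -p) = C * (n : ℝ) ^ (1 - p * θ) := by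
      rw [show 1 - p * θ = 1 + θ * -p by ring, Real.rpow_add hn', Real.rpow_one]; ring
    linarith
  have hlim : Tendsto (fun n : ℕ => 1 - C * (n : ℝ) ^ (1 - p * θ)) atTop (𝓝 1) := by
    have h6 : Tendsto (fun n : ℕ => (n : ℝ) ^ (-(p * θ - 1))) atTop (𝓝 0) :=
      (tendsto_rpow_neg_atTop (by linarith)).comp tendsto_natCast_atTop_atTop
    have := (h6.const_mul C).const_sub 1
    simpa using this
  exact tendsto_of_tendsto_of_tendsto_of_le_of_le' hlim tendsto_const_nhds hlow
    (Eventually.of_forall fun n => measureReal_le_one)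

end Moments

/-! ### The conditioned and adjusted bi-degree sequence. -/

section BiDegree

variable {F G : Measure ℕ} {α β δ₀ : ℝ}

theorem acceptedLaw_real_le [IsProbabilityMeasure F] [IsProbabilityMeasure G] {n : ℕ}
    (h : 1 / 2 ≤ (sampleLaw F G n).real (accept α β δ₀ n)) (S : Set (BiDegree n)) :
    (acceptedLaw F G α β δ₀ n).real S ≤
      2 * (sampleLaw F G n).real (accept α β δ₀ n ∩ S) := by
  rw [acceptedLaw, measureReal_def, cond_apply MeasurableSet.of_discrete, ENNReal.toReal_mul,
    ENNReal.toReal_inv, ← measureReal_def, ← measureReal_def]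
  refine mul_le_mul_of_nonneg_right ?_ measureReal_nonneg
  rw [inv_le_comm₀ (by linarith) (by norm_num)]
  linarith

theorem exists_ncard_eq {n m : ℕ} (h : m ≤ n) : {A : Set (Fin n) | A.ncard = m}.Nonempty := by
  obtain ⟨A, -, hA⟩ := Set.exists_subset_card_eq (s := (Set.univ : Set (Fin n))) (n := m)
    (by simpa [Set.ncard_univ] using h)
  exact ⟨A, hA⟩

theorem uniformOn_le_one {Ω : Type*} [MeasurableSpace Ω] [MeasurableSingletonClass Ω] [Finite Ω]
    (s t : Set Ω) : uniformOn s t ≤ 1 := by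
  rcases s.eq_empty_or_nonempty with rfl | hs
  · simp
  · have := isProbabilityMeasure_uniformOn s.toFinite hs
    exact prob_le_one

theorem accept_natAbs_le {n : ℕ} (hn : 1 ≤ n) (hδ : δ₀ < kappa α β) {x : BiDegree n}
    (hx : x ∈ accept α β δ₀ n) : (disc x).natAbs ≤ n := by
  have h1 : |(disc x : ℝ)| ≤ (n : ℝ) ^ (1 - kappa α β + δ₀) := hx
  have h2 : (n : ℝ) ^ (1 - kappa α β + δ₀) ≤ (n : ℝ) ^ (1 : ℝ) :=
    Real.rpow_le_rpow_of_exponent_le (by exact_mod_cast hn) (by linarith)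
  rw [Real.rpow_one] at h2
  have h3 : (((disc x).natAbs : ℕ) : ℝ) ≤ n := by
    rw [Nat.cast_natAbs, Int.cast_abs]
    exact h1.trans h2
  exact_mod_cast h3

/-- The kernel that chooses the adjusted nodes. -/
noncomputable abbrev nodesKernel (n : ℕ) : Kernel (BiDegree n) (Set (Fin n)) :=
  Kernel.ofFunOfCountable (fun x => uniformOn {A : Set (Fin n) | A.ncard = (disc x).natAbs})

instance (n : ℕ) : IsFiniteKernel (nodesKernel n) :=
  ⟨⟨1, ENNReal.one_lt_top, fun _ => uniformOn_le_one _ _⟩⟩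

theorem ae_accept [IsProbabilityMeasure F] [IsProbabilityMeasure G] (n : ℕ) :
    ∀ᵐ x ∂acceptedLaw F G α β δ₀ n, x ∈ accept α β δ₀ n :=
  ae_cond_mem MeasurableSet.of_discrete

theorem biDegreeLaw_apply (n : ℕ) [IsProbabilityMeasure F] [IsProbabilityMeasure G]
    (S : Set (BiDegree n)) :
    biDegreeLaw F G α β δ₀ n S = ∫⁻ x, nodesKernel n x {A | adjust x A ∈ S}
      ∂acceptedLaw F G α β δ₀ n := by
  have : IsFiniteMeasure (acceptedLaw F G α β δ₀ n) := by
    unfold acceptedLaw; infer_instance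
  rw [biDegreeLaw, Measure.map_apply (measurable_of_countable _) MeasurableSet.of_discrete,
    Measure.compProd_apply MeasurableSet.of_discrete]
  rfl

/-- The uniform law on sets of |Δ| nodes is the zero measure if |Δ| > n; acceptance excludes this,
since its threshold is a power of n with exponent below one. -/
theorem isProbabilityMeasure_biDegreeLaw [IsProbabilityMeasure F] [IsProbabilityMeasure G] {n : ℕ}
    (hn : 1 ≤ n) (hδ : δ₀ < kappa α β)
    (h : (sampleLaw F G n).real (accept α β δ₀ n) ≠ 0) :
    IsProbabilityMeasure (biDegreeLaw F G α β δ₀ n) := by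
  have hP : IsProbabilityMeasure (acceptedLaw F G α β δ₀ n) :=
    cond_isProbabilityMeasure fun h0 => h (by rw [measureReal_def, h0, ENNReal.toReal_zero])
  refine ⟨?_⟩
  rw [biDegreeLaw_apply]
  calc _ = ∫⁻ x, 1 ∂acceptedLaw F G α β δ₀ n := by
        refine lintegral_congr_ae ?_
        filter_upwards [ae_accept n] with x hx
        have : IsProbabilityMeasure (nodesKernel n x) := isProbabilityMeasure_uniformOn (Set.toFinite _)
          (exists_ncard_eq (accept_natAbs_le hn hδ hx))
        simp only [Set.mem_univ, Set.ofPred_true]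
        exact measure_univ
    _ = 1 := by simp

/-- Reduces a bad event for the adjusted sequence to one for the samples, when the implication holds
for every admissible choice of nodes. -/
theorem biDegreeLaw_le [IsProbabilityMeasure F] [IsProbabilityMeasure G] {n : ℕ}
    (S : Set (BiDegree n)) (B : Set (BiDegree n))
    (hSB : ∀ x ∈ accept α β δ₀ n, x ∉ B → ∀ A : Set (Fin n), A.ncard = (disc x).natAbs →
      adjust x A ∉ S) :
    biDegreeLaw F G α β δ₀ n S ≤ acceptedLaw F G α β δ₀ n B := by
  rw [biDegreeLaw_apply, ← lintegral_indicator_one MeasurableSet.of_discrete]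
  refine lintegral_mono_ae ?_
  filter_upwards [ae_accept n] with x hx
  by_cases hB : x ∈ B
  · rw [Set.indicator_of_mem hB]
    exact uniformOn_le_one _ _
  · refine le_of_eq_of_le ?_ zero_le
    refine (uniformOn_eq_zero_iff (Set.toFinite _)).2 ?_
    ext A
    simp only [Set.mem_inter_iff, Set.mem_ofPred_eq, Set.mem_empty_iff_false, iff_false, not_and]
    exact hSB x hx hB A

/-- Three laws of large numbers with rate, for `truncProd`, 𝒟 and 𝒟². They share an order p with 1 <
p < α and 2p < β, so that 𝒟² has a p-th moment too. -/
theorem exists_biDegreeLaw_not_goodDegrees_le [IsProbabilityMeasure F] [IsProbabilityMeasure G]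
    (hα : 1 < α) (hβ : 2 < β) (hF : TailBound F α) (hG : TailBound G β) {μ : ℝ}
    (hμF : ∫ k, (k : ℝ) ∂F = μ) (hμG : ∫ k, (k : ℝ) ∂G = μ) (hμ : 1 < μ)
    (hδ₀ : 0 < δ₀) (hδ₀' : δ₀ < kappa α β) {lam : ℝ} (hlam : μ < lam) :
    ∃ b : ℝ, 0 < b ∧ ∃ δ : ℝ, 0 < δ ∧ ∃ C : ℝ, 0 ≤ C ∧ ∀ᶠ n : ℕ in atTop,
      IsProbabilityMeasure (biDegreeLaw F G α β δ₀ n) ∧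
      (biDegreeLaw F G α β δ₀ n).real {x | ¬ GoodDegrees lam b x} ≤ C * (n : ℝ) ^ (-δ) := by
  obtain ⟨p, hp1, hp2⟩ := exists_between (lt_min hα (by linarith : 1 < β / 2))
  have hpα : p < α := hp2.trans_le (min_le_left _ _)
  have hpβ : 2 * p < β := by linarith [hp2.trans_le (min_le_right _ _)]
  have hp0 : 0 < p := by linarith
  have hFp := hF.memLp hp0 hpα
  have hGp := hG.memLp hp0 (by linarith : p < β)
  have hone : 1 ≤ ENNReal.ofReal p := by simpa using hp1.le
  have hFi : Integrable (fun k : ℕ => (k : ℝ)) F := hFp.integrable hone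
  have hGi : Integrable (fun k : ℕ => (k : ℝ)) G := hGp.integrable hone
  have hG2 : MemLp (fun k : ℕ => (k : ℝ) ^ 2) (ENNReal.ofReal p) G := by
    rw [← integrable_norm_rpow_iff (measurable_of_countable _).aestronglyMeasurable
      (by simpa using hp0) ENNReal.ofReal_ne_top, ENNReal.toReal_ofReal hp0.le]
    refine (hG.integrable_rpow (by linarith) hpβ).congr (Eventually.of_forall fun k => ?_)
    simp only [Real.norm_eq_abs, abs_pow, Nat.abs_cast]
    rw [← Real.rpow_natCast, ← Real.rpow_mul (by positivity)]
    norm_num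
  -- The last condition is μ² + 3η ≤ λ(μ - η): one η each for the truncation at K, the deviation of
  -- the products and the adjustment, and one for the deviation of the out-degrees on the right. The
  -- condition η ≤ μ - 1 keeps ∑D at least n.
  obtain ⟨η, hη0, hη1, hη2⟩ : ∃ η : ℝ, 0 < η ∧ η ≤ μ - 1 ∧ η * (3 + lam) ≤ μ * (lam - μ) := by
    refine ⟨min (μ - 1) (μ * (lam - μ) / (3 + lam)), lt_min (by linarith)
      (div_pos (mul_pos (by linarith) (by linarith)) (by linarith)), min_le_left _ _, ?_⟩
    rw [← le_div_iff₀ (by linarith)]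
    exact min_le_right _ _
  have hK := (tendsto_integral_truncProd hFi hGi).eventually_lt_const
    (show (∫ k, (k : ℝ) ∂F) * ∫ k, (k : ℝ) ∂G < μ * μ + η by rw [hμF, hμG]; linarith)
  obtain ⟨K, hK⟩ := hK.exists
  have hKnn : (0 : ℝ) ≤ K := by positivity
  obtain ⟨δ₁, hδ₁, C₁, h₁⟩ := exists_sampleLaw_deviation_le hp1
    (memLp_truncProd hp0 hFp hGp hKnn) hη0
  obtain ⟨δ₂, hδ₂, C₂, h₂⟩ := exists_sampleLaw_deviation_le hp1 (hGp.comp_snd F) hη0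
  obtain ⟨δ₃, hδ₃, C₃, h₃⟩ := exists_sampleLaw_deviation_le hp1 (hG2.comp_snd F) one_pos
  rw [integral_fun_snd (fun k : ℕ => (k : ℝ))] at h₂
  rw [integral_fun_snd (fun k : ℕ => (k : ℝ) ^ 2)] at h₃
  simp only [probReal_univ, one_smul, hμG] at h₂ h₃
  set E2 := ∫ k, (k : ℝ) ^ 2 ∂G with hE2
  have hE2' : 0 ≤ E2 := integral_nonneg fun k => by positivity
  -- From (d + 1)² ≤ 2d² + 2 and a deviation of ∑𝒟² of at most n.
  refine ⟨2 * (E2 + 1) + 2, by positivity, min δ₁ (min δ₂ δ₃), by positivity,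
    2 * (|C₁| + |C₂| + |C₃|), by positivity, ?_⟩
  have hacc := (tendsto_sampleLaw_accept hα hβ hF hG (by rw [hμF, hμG]) hδ₀ hδ₀').eventually_const_le
    (show (1 / 2 : ℝ) < 1 by norm_num)
  have hsmall : ∀ᶠ n : ℕ in atTop, K * (n : ℝ) ^ (1 - kappa α β + δ₀) ≤ η * n := by
    have h6 : Tendsto (fun n : ℕ => (n : ℝ) ^ (-(kappa α β - δ₀))) atTop (𝓝 0) :=
      (tendsto_rpow_neg_atTop (by linarith)).comp tendsto_natCast_atTop_atTop
    have h7 := (h6.const_mul (K : ℝ)).eventually_lt_const (show (K : ℝ) * 0 < η by simpa using hη0)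
    filter_upwards [h7, eventually_ge_atTop 1] with n hn hn1
    have hn' : (0 : ℝ) < n := by exact_mod_cast hn1
    rw [show 1 - kappa α β + δ₀ = -(kappa α β - δ₀) + 1 by ring, Real.rpow_add hn', Real.rpow_one,
      ← mul_assoc]
    gcongr
  filter_upwards [hacc, hsmall, eventually_ge_atTop 1] with n hn hs hn1
  have hn' : (1 : ℝ) ≤ n := by exact_mod_cast hn1
  refine ⟨isProbabilityMeasure_biDegreeLaw hn1 hδ₀' (by linarith), ?_⟩
  set B₁ := {x : BiDegree n | η * n < |∑ i, truncProd K (x.1 i, x.2 i) -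
    n * ∫ y, truncProd K y ∂F.prod G|} with hB₁
  set B₂ := {x : BiDegree n | η * n < |∑ i, (x.2 i : ℝ) - n * μ|} with hB₂
  set B₃ := {x : BiDegree n | 1 * n < |∑ i, (x.2 i : ℝ) ^ 2 - n * E2|} with hB₃
  have hle := biDegreeLaw_le (F := F) (G := G) (α := α) (β := β) (δ₀ := δ₀)
    {x : BiDegree n | ¬ GoodDegrees lam (2 * (E2 + 1) + 2) x} (B₁ ∪ (B₂ ∪ B₃)) ?_
  · have hcf : IsFiniteMeasure (acceptedLaw F G α β δ₀ n) := by
      unfold acceptedLaw; infer_instance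
    have hle' := ENNReal.toReal_mono (measure_ne_top _ _) hle
    refine hle'.trans ((acceptedLaw_real_le hn _).trans ?_)
    have hmono : (sampleLaw F G n).real (accept α β δ₀ n ∩ (B₁ ∪ (B₂ ∪ B₃))) ≤
        (sampleLaw F G n).real B₁ + ((sampleLaw F G n).real B₂ + (sampleLaw F G n).real B₃) :=
      (measureReal_mono Set.inter_subset_right).trans ((measureReal_union_le _ _).trans
        (add_le_add_right (measureReal_union_le _ _) _))
    have hpow : ∀ (δ' C' : ℝ), min δ₁ (min δ₂ δ₃) ≤ δ' →
        C' * (n : ℝ) ^ (-δ') ≤ |C'| * (n : ℝ) ^ (-min δ₁ (min δ₂ δ₃)) := by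
      intro δ' C' h
      have : (n : ℝ) ^ (-δ') ≤ (n : ℝ) ^ (-min δ₁ (min δ₂ δ₃)) :=
        Real.rpow_le_rpow_of_exponent_le hn' (by linarith)
      calc C' * (n : ℝ) ^ (-δ') ≤ |C'| * (n : ℝ) ^ (-δ') := by gcongr; exact le_abs_self _
        _ ≤ _ := by gcongr
    have k1 := (h₁ n hn1).trans (hpow δ₁ C₁ (min_le_left _ _))
    have k2 := (h₂ n hn1).trans (hpow δ₂ C₂ ((min_le_right _ _).trans (min_le_left _ _)))
    have k3 := (h₃ n hn1).trans (hpow δ₃ C₃ ((min_le_right _ _).trans (min_le_right _ _)))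
    linarith
  · intro x hx hB A hA hng
    refine hng ?_
    simp only [hB₁, hB₂, hB₃, Set.mem_union, Set.mem_ofPred_eq, not_or, not_lt] at hB
    obtain ⟨b1, b2, b3⟩ := hB
    have hAn : K * (A.ncard : ℝ) ≤ η * n := by
      refine le_trans ?_ hs
      gcongr
      rw [hA, Nat.cast_natAbs, Int.cast_abs]
      exact hx
    have e1 := (abs_le.1 b1).2
    have e2 := (abs_le.1 b2).1
    have e3 := (abs_le.1 b3).2
    have hD := le_sum_adjust x A
    have hprod := sum_adjust_mul_le x A (K : ℝ)
    have hsq := sum_adjust_sq_le x A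
    refine ⟨sum_adjust_eq x A hA, ?_, ?_, ?_⟩
    · have hmean : (n : ℝ) * ∫ y, truncProd K y ∂F.prod G ≤ n * (μ * μ + η) := by gcongr
      have hlamD : lam * (n * (μ - η)) ≤ lam * ∑ i, ((adjust x A).2 i : ℝ) :=
        mul_le_mul_of_nonneg_left (by linarith) (by linarith)
      have : (n : ℝ) * (η * (3 + lam)) ≤ n * (μ * (lam - μ)) := by gcongr
      nlinarith
    · have : (n : ℝ) * 1 ≤ n * (μ - η) := by gcongr; linarith
      linarith
    · linarith

end BiDegree

/-! ### The exploration as a function of the sequence of paired stubs -/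

variable {n : ℕ}

/-- The nodes attached after `t` steps, if the stubs that are paired are `q 0, q 1, …`. -/
def nodesAfter (N : Fin n → ℕ) (root : Fin n) (q : ℕ → Stub n) : ℕ → List (Fin n)
  | 0 => [root]
  | t + 1 =>
    let v := extend N t (nodesAfter N root q t)
    if (q t).1 ∈ v then v else v ++ [(q t).1]

/-- The outbound stub that is paired in step `t` of the exploration. -/
noncomputable def pairedStub (N : Fin n → ℕ) (root : Fin n) (w : ℕ × ℕ → Stub n) (t : ℕ) : Stub n :=
  firstUnpaired (explore N root w t).2 fun m => w (t, m)

/-- Separates the two components: the attached nodes depend on the draws only through the paired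
stubs. -/
theorem explore_eq (N : Fin n → ℕ) (root : Fin n) (w : ℕ × ℕ → Stub n) (t : ℕ) :
    explore N root w t =
      (nodesAfter N root (pairedStub N root w) t, (List.range t).map (pairedStub N root w)) := by
  induction t with
  | zero => rfl
  | succ t ih =>
    have h : firstUnpaired (explore N root w t).2 (fun m => w (t, m)) = pairedStub N root w t := rfl
    simp only [explore, nodesAfter, List.range_succ, List.map_append, List.map_cons, List.map_nil, h]
    rw [ih]

theorem pairedStub_eq (N : Fin n → ℕ) (root : Fin n) (w : ℕ × ℕ → Stub n) (t : ℕ) :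
    pairedStub N root w t =
      firstUnpaired ((List.range t).map (pairedStub N root w)) fun m => w (t, m) := by
  conv_lhs => rw [pairedStub, explore_eq]

theorem nodesAfter_congr {N : Fin n → ℕ} {root : Fin n} {q q' : ℕ → Stub n} {t : ℕ}
    (h : ∀ s < t, q s = q' s) : nodesAfter N root q t = nodesAfter N root q' t := by
  induction t with
  | zero => rfl
  | succ t ih =>
    simp only [nodesAfter, ih fun s hs => h s (by omega), h t (by omega)]

theorem extend_prefix (N : Fin n → ℕ) (t : ℕ) (v : List (Fin n)) : v <+: extend N t v := by
  unfold extend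
  split_ifs
  · exact List.prefix_append _ _
  · exact List.prefix_rfl

theorem extend_nodesAfter_prefix (N : Fin n → ℕ) (root : Fin n) (q : ℕ → Stub n) (t : ℕ) :
    extend N t (nodesAfter N root q t) <+: nodesAfter N root q (t + 1) := by
  simp only [nodesAfter]
  split_ifs
  · exact List.prefix_rfl
  · exact List.prefix_append _ _

theorem nodesAfter_prefix (N : Fin n → ℕ) (root : Fin n) (q : ℕ → Stub n) {s t : ℕ} (h : s ≤ t) :
    nodesAfter N root q s <+: nodesAfter N root q t := by
  induction t, h using Nat.le_induction with
  | base => exact List.prefix_rfl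
  | succ t _ ih =>
    exact ih.trans ((extend_prefix N t _).trans (extend_nodesAfter_prefix N root q t))

theorem nodup_extend {N : Fin n → ℕ} {t : ℕ} {v : List (Fin n)} (hv : v.Nodup) :
    (extend N t v).Nodup := by
  unfold extend
  split_ifs
  · refine List.Nodup.append hv ((List.nodup_finRange n).filter _) fun i hi hi' => ?_
    simp only [List.mem_filter, decide_eq_true_eq] at hi'
    exact hi'.2 hi
  · exact hv

theorem nodup_nodesAfter (N : Fin n → ℕ) (root : Fin n) (q : ℕ → Stub n) (t : ℕ) :
    (nodesAfter N root q t).Nodup := by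
  induction t with
  | zero => simp [nodesAfter]
  | succ t ih =>
    simp only [nodesAfter]
    split_ifs with h
    · exact nodup_extend ih
    · exact List.Nodup.append (nodup_extend ih) (List.nodup_singleton _)
        (by simpa [List.disjoint_singleton] using h)

theorem length_inbound (N : Fin n → ℕ) (v : List (Fin n)) : (inbound N v).length = (v.map N).sum := by
  simp [inbound, List.length_flatMap]

theorem inbound_append (N : Fin n → ℕ) (u v : List (Fin n)) :
    inbound N (u ++ v) = inbound N u ++ inbound N v := by
  simp [inbound]

theorem inbound_prefix (N : Fin n → ℕ) {u v : List (Fin n)} (h : u <+: v) :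
    inbound N u <+: inbound N v := by
  obtain ⟨r, rfl⟩ := h
  rw [inbound_append]
  exact List.prefix_append _ _

theorem length_inbound_le {N : Fin n → ℕ} {v : List (Fin n)} (hv : v.Nodup) :
    (inbound N v).length ≤ ∑ i, N i := by
  rw [length_inbound, ← List.sum_toFinset N hv]
  exact Finset.sum_le_univ_sum_of_nonneg fun _ => Nat.zero_le _

/-- When the explored part is exhausted, `extend` adds all other nodes, so every step before the
last stub finds an inbound stub to pair. -/
theorem lt_length_inbound_extend {N : Fin n → ℕ} {t : ℕ} {v : List (Fin n)} (hv : v.Nodup)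
    (ht : t < ∑ i, N i) : t < (inbound N (extend N t v)).length := by
  by_cases h : (inbound N v).length ≤ t
  · rw [length_inbound, ← List.sum_toFinset N (nodup_extend hv)]
    have : (extend N t v).toFinset = Finset.univ := by
      ext i
      by_cases hi : i ∈ v <;> simp [extend, h, hi]
    rwa [this]
  · rw [extend, if_neg h]
    omega

theorem length_inbound_nodesAfter (N : Fin n → ℕ) (root : Fin n) (q : ℕ → Stub n) :
    (inbound N (nodesAfter N root q (∑ i, N i))).length = ∑ i, N i := by
  refine le_antisymm (length_inbound_le (nodup_nodesAfter _ _ _ _)) ?_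
  rcases Nat.eq_zero_or_pos (∑ i, N i) with h | h
  · omega
  · obtain ⟨L, hL⟩ : ∃ L, ∑ i, N i = L + 1 := ⟨_, (Nat.succ_pred_eq_of_pos h).symm⟩
    have h1 : L < (inbound N (extend N L (nodesAfter N root q L))).length :=
      lt_length_inbound_extend (nodup_nodesAfter _ _ _ _) (by omega)
    have h2 := (inbound_prefix N (extend_nodesAfter_prefix N root q L)).length_le
    rw [hL]
    omega

theorem countP_range (p : ℕ → Bool) (L : ℕ) :
    (List.range L).countP p = ((Finset.range L).filter fun t => p t = true).card := by
  change _ = Multiset.card (Multiset.filter _ (Multiset.range L))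
  rw [Multiset.range, Multiset.filter_coe, Multiset.coe_card, List.countP_eq_length_filter]
  simp

/-- Indexes the edges by exploration step. The default `root` of `getD` is never read, because the
final list has one entry per inbound stub. -/
theorem edges_eq_card (N : Fin n → ℕ) (root : Fin n) (w : ℕ × ℕ → Stub n) (i j : Fin n) :
    edges N root w i j = ((Finset.range (∑ i, N i)).filter fun t =>
      (pairedStub N root w t).1 = i ∧
        (inbound N (nodesAfter N root (pairedStub N root w) (∑ i, N i))).getD t root = j).card := by
  simp only [edges, explore_eq]
  set q := pairedStub N root w
  set V := nodesAfter N root q (∑ i, N i) with hV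
  have hlen : (inbound N V).length = ∑ i, N i := length_inbound_nodesAfter N root q
  have hz : ((List.range (∑ i, N i)).map q).zip (inbound N V) =
      (List.range (∑ i, N i)).map fun t => (q t, (inbound N V).getD t root) := by
    refine List.ext_getElem (by simp [hlen]) fun t h1 h2 => ?_
    have ht : t < (inbound N V).length := by simp at h2; omega
    simp [ht]
  rw [hz, List.countP_map, countP_range]
  simp

/-! ### Matchings of the stubs -/

/-- The inbound stubs. -/
abbrev InStub (N : Fin n → ℕ) := Σ i, Fin (N i)

/-- The labelled inbound stubs of the nodes in a list. -/
def inStubs (N : Fin n → ℕ) (v : List (Fin n)) : List (InStub N) :=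
  v.sigma fun i => List.finRange (N i)

theorem map_fst_inStubs (N : Fin n → ℕ) (v : List (Fin n)) :
    (inStubs N v).map Sigma.fst = inbound N v := by
  induction v with
  | nil => rfl
  | cons i v ih =>
    simp only [inStubs, inbound, List.sigma_cons, List.map_append, List.flatMap_cons,
      List.map_map] at ih ⊢
    rw [ih]
    congr 1
    rw [show (Sigma.fst ∘ fun a : Fin (N i) => (⟨i, a⟩ : InStub N)) = fun _ => i from rfl]
    simp

theorem inStubs_prefix (N : Fin n → ℕ) {u v : List (Fin n)} (h : u <+: v) :
    inStubs N u <+: inStubs N v := by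
  obtain ⟨r, rfl⟩ := h
  simp only [inStubs]
  induction u with
  | nil => exact List.nil_prefix
  | cons i u ih =>
    rw [List.cons_append, List.sigma_cons, List.sigma_cons]
    exact (List.prefix_append_right_inj _).2 ih

theorem nodup_inStubs (N : Fin n → ℕ) {v : List (Fin n)} (hv : v.Nodup) : (inStubs N v).Nodup :=
  hv.sigma fun _ => List.nodup_finRange _

theorem length_inStubs (N : Fin n → ℕ) (v : List (Fin n)) :
    (inStubs N v).length = (inbound N v).length := by
  rw [← map_fst_inStubs, List.length_map]

/-- The outbound stubs. -/
abbrev OutStub (D : Fin n → ℕ) := Σ i, Fin (D i)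

/-- An outbound stub as an element of `Stub n`. -/
def OutStub.toStub {D : Fin n → ℕ} (e : OutStub D) : Stub n := (e.1, e.2)

theorem OutStub.toStub_injective {D : Fin n → ℕ} :
    Function.Injective (OutStub.toStub : OutStub D → Stub n) := by
  rintro ⟨i, a⟩ ⟨j, b⟩ h
  simp only [OutStub.toStub, Prod.mk.injEq] at h
  obtain ⟨rfl, h⟩ := h
  rw [Fin.ext h]

/-! ### Orderings of the outbound stubs correspond bijectively to matchings. -/

section Ordering

variable {N D : Fin n → ℕ} (root : Fin n)

/-- The sequence of stubs given by an ordering of the outbound stubs. -/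
def stubSeq {L : ℕ} (q : Fin L ≃ OutStub D) (t : ℕ) : Stub n :=
  if h : t < L then (q ⟨t, h⟩).toStub else (root, 0)

theorem stubSeq_fin {L : ℕ} (q : Fin L ≃ OutStub D) (t : Fin L) :
    stubSeq root q t = (q t).toStub := by
  simp [stubSeq]

theorem length_inStubs_nodesAfter (N : Fin n → ℕ) (q : ℕ → Stub n) :
    (inStubs N (nodesAfter N root q (∑ i, N i))).length = ∑ i, N i := by
  rw [length_inStubs, length_inbound_nodesAfter]

/-- The inbound stub paired in step `t` of the exploration. -/
def inStubAt (q : Fin (∑ i, N i) ≃ OutStub D) (t : Fin (∑ i, N i)) : InStub N :=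
  (inStubs N (nodesAfter N root (stubSeq root q) (∑ i, N i)))[(t : ℕ)]'(by
    rw [length_inStubs_nodesAfter]; exact t.2)

theorem inStubAt_bijective (q : Fin (∑ i, N i) ≃ OutStub D) :
    Function.Bijective (inStubAt root q) := by
  rw [Fintype.bijective_iff_injective_and_card]
  refine ⟨fun s t h => ?_, by simp⟩
  have := (List.Nodup.getElem_inj_iff (nodup_inStubs N (nodup_nodesAfter N root _ _))).1 h
  exact Fin.ext this

/-- The matching of the stubs found by the exploration from `root`, if the outbound stubs are paired
in the order `q`. -/
noncomputable def matching (q : Fin (∑ i, N i) ≃ OutStub D) : InStub N ≃ OutStub D :=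
  (Equiv.ofBijective _ (inStubAt_bijective root q)).symm.trans q

theorem matching_inStubAt (q : Fin (∑ i, N i) ≃ OutStub D) (t : Fin (∑ i, N i)) :
    matching root q (inStubAt root q t) = q t := by
  simp only [matching, Equiv.trans_apply]
  congr 1
  rw [Equiv.symm_apply_eq]
  rfl

/-- The exploration does not look ahead: the node list known before pairing t is a prefix of the
final one and already contains the t-th inbound stub. -/
theorem inStubAt_eq_of_forall_lt {q q' : Fin (∑ i, N i) ≃ OutStub D} (t : Fin (∑ i, N i))
    (h : ∀ s < t, q s = q' s) : inStubAt root q t = inStubAt root q' t := by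
  have key : ∀ q : Fin (∑ i, N i) ≃ OutStub D,
      some (inStubAt root q t) =
        (inStubs N (extend N t (nodesAfter N root (stubSeq root q) t)))[(t : ℕ)]? := by
    intro q
    have hp : extend N t (nodesAfter N root (stubSeq root q) t) <+:
        nodesAfter N root (stubSeq root q) (∑ i, N i) :=
      (extend_nodesAfter_prefix N root _ t).trans (nodesAfter_prefix N root _ t.2)
    have hlt : (t : ℕ) < (inStubs N (extend N t (nodesAfter N root (stubSeq root q) t))).length := by
      rw [length_inStubs]
      exact lt_length_inbound_extend (nodup_nodesAfter _ _ _ _) t.2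
    rw [List.getElem?_eq_getElem hlt, inStubAt, (inStubs_prefix N hp).getElem hlt]
  have hn : nodesAfter N root (stubSeq root q) t = nodesAfter N root (stubSeq root q') t := by
    refine nodesAfter_congr fun s hs => ?_
    have hs' : s < ∑ i, N i := hs.trans t.2
    rw [stubSeq, stubSeq, dif_pos hs', dif_pos hs', h ⟨s, hs'⟩ hs]
  have := key q
  rw [hn, ← key q'] at this
  exact Option.some_injective _ this

/-- The matching determines the ordering recursively: the earlier stubs fix the next inbound stub,
and the matching then gives its partner. -/
theorem matching_injective :
    Function.Injective (matching root : (Fin (∑ i, N i) ≃ OutStub D) → _) := by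
  intro q q' h
  ext1 t
  induction t using WellFoundedLT.induction with
  | _ t ih =>
    have h1 := inStubAt_eq_of_forall_lt root t ih
    rw [← matching_inStubAt root q t, ← matching_inStubAt root q' t, h1, h]

theorem matching_bijective (hND : ∑ i, N i = ∑ i, D i) :
    Function.Bijective (matching root : (Fin (∑ i, N i) ≃ OutStub D) → _) := by
  rw [Fintype.bijective_iff_injective_and_card]
  refine ⟨matching_injective root, ?_⟩
  rw [Fintype.card_equiv (finCongr (by simp : ∑ i, N i = Fintype.card (InStub N)) |>.trans
      (Fintype.equivFin _).symm |>.trans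
      (Fintype.equivOfCardEq (by simp [hND]) : InStub N ≃ OutStub D)),
    Fintype.card_equiv (Fintype.equivOfCardEq (by simp [hND]) : InStub N ≃ OutStub D)]
  simp

/-- The number of edges from `i` to `j` in the graph given by a matching. -/
def matchEdges (m : InStub N ≃ OutStub D) (i j : Fin n) : ℕ :=
  (Finset.univ.filter fun a : InStub N => (m a).1 = i ∧ a.1 = j).card

theorem inStubAt_fst (q : Fin (∑ i, N i) ≃ OutStub D) (t : Fin (∑ i, N i)) :
    (inStubAt root q t).1 =
      (inbound N (nodesAfter N root (stubSeq root q) (∑ i, N i))).getD t root := by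
  have ht : (t : ℕ) < (inbound N (nodesAfter N root (stubSeq root q) (∑ i, N i))).length := by
    rw [length_inbound_nodesAfter]; exact t.2
  rw [List.getD_eq_getElem _ _ ht]
  simp only [← map_fst_inStubs, List.getElem_map, inStubAt]

theorem edges_eq_matchEdges {w : ℕ × ℕ → Stub n} {q : Fin (∑ i, N i) ≃ OutStub D}
    (h : ∀ t < ∑ i, N i, pairedStub N root w t = stubSeq root q t) :
    edges N root w = matchEdges (matching root q) := by
  ext i j
  rw [edges_eq_card, nodesAfter_congr h, matchEdges]
  refine Finset.card_bij
    (fun t ht => inStubAt root q ⟨t, Finset.mem_range.1 (Finset.mem_filter.1 ht).1⟩) ?_ ?_ ?_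
  · intro t ht
    simp only [Finset.mem_filter, Finset.mem_range] at ht
    obtain ⟨ht, h1, h2⟩ := ht
    rw [Finset.mem_filter, matching_inStubAt, inStubAt_fst]
    have h3 : (stubSeq root q t).1 = i := by rw [← h t ht, h1]
    rw [stubSeq, dif_pos ht] at h3
    exact ⟨Finset.mem_univ _, h3, h2⟩
  · intro s hs t ht hst
    simpa using (inStubAt_bijective root q).1 hst
  · intro a ha
    obtain ⟨t, rfl⟩ := (inStubAt_bijective root q).2 a
    rw [Finset.mem_filter, matching_inStubAt, inStubAt_fst] at ha
    refine ⟨t, ?_, rfl⟩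
    simp only [Finset.mem_filter, Finset.mem_range]
    refine ⟨t.2, ?_, ha.2.2⟩
    rw [h t t.2, stubSeq_fin]
    exact ha.2.1

end Ordering

/-! ### The law of the sequence of paired stubs -/

theorem lintegral_stubLaw {D : Fin n → ℕ} (root : Fin n) (hD : 0 < ∑ i, D i) (f : Stub n → ℝ≥0∞) :
    ∫⁻ e, f e ∂stubLaw D root = ((∑ i, D i : ℕ) : ℝ≥0∞)⁻¹ * ∑ a : OutStub D, f a.toStub := by
  have hS : {e : Stub n | e.2 < D e.1} =
      (((Finset.univ : Finset (OutStub D)).map ⟨OutStub.toStub, OutStub.toStub_injective⟩ : Finset (Stub n)) :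
        Set (Stub n)) := by
    ext ⟨i, b⟩
    simp only [Set.mem_ofPred_eq, Finset.coe_map, Function.Embedding.coeFn_mk, Finset.coe_univ,
      Set.image_univ, Set.mem_range]
    constructor
    · exact fun h => ⟨⟨i, b, h⟩, rfl⟩
    · rintro ⟨⟨j, a⟩, h⟩
      simp only [OutStub.toStub, Prod.mk.injEq] at h
      obtain ⟨rfl, rfl⟩ := h
      exact a.2
  rw [stubLaw, if_pos hD, uniformOn, hS, ProbabilityTheory.cond, lintegral_smul_measure, lintegral_finset,
    Measure.count_apply_finset, Finset.card_map, Finset.sum_map]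
  simp

instance (D : Fin n → ℕ) (root : Fin n) : IsProbabilityMeasure (stubLaw D root) := by
  by_cases hD : 0 < ∑ i, D i
  · refine ⟨?_⟩
    rw [← lintegral_one, lintegral_stubLaw root hD]
    simp only [Finset.sum_const, Finset.card_univ, Fintype.card_sigma, Fintype.card_fin,
      nsmul_eq_mul, mul_one]
    exact ENNReal.inv_mul_cancel (by exact_mod_cast hD.ne') (ENNReal.natCast_ne_top _)
  · rw [stubLaw, if_neg hD]
    infer_instance

theorem stubLaw_toStub {D : Fin n → ℕ} (root : Fin n) (hD : 0 < ∑ i, D i) (a : OutStub D) :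
    stubLaw D root {a.toStub} = ((∑ i, D i : ℕ) : ℝ≥0∞)⁻¹ := by
  classical
  rw [← lintegral_indicator_one (measurableSet_singleton _), lintegral_stubLaw root hD,
    Finset.sum_eq_single a]
  · simp
  · intro b _ hb
    have hb' : b.toStub ∉ ({a.toStub} : Set (Stub n)) := fun h => hb (OutStub.toStub_injective h)
    exact Set.indicator_of_notMem hb' _
  · simp

/-- If all draws lie in `l`, the infimum is the default 0 and the value is `d 0`, a member of `l`;
hence this case cannot produce an `e` outside `l`. -/
theorem firstUnpaired_eq_iff {l : List (Stub n)} {e : Stub n} (he : e ∉ l) (d : ℕ → Stub n) :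
    firstUnpaired l d = e ↔ ∃ m, (∀ j < m, d j ∈ l) ∧ d m = e := by
  constructor
  · intro h
    refine ⟨sInf {m | d m ∉ l}, fun j hj => ?_, h⟩
    by_contra hc
    exact Nat.notMem_of_lt_sInf hj hc
  · rintro ⟨m, hm, rfl⟩
    have : sInf {k | d k ∉ l} = m := by
      refine le_antisymm (Nat.sInf_le he) (le_csInf ⟨m, he⟩ fun k hk => ?_)
      by_contra hc
      exact hk (hm k (by omega))
    rw [firstUnpaired, this]

/-! ### The law of one pairing with redraws, and the independence of the rows of draws. -/

section Order

variable (ρ : Measure (Stub n)) [IsProbabilityMeasure ρ]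

theorem measurableSet_firstUnpaired {l : List (Stub n)} {e : Stub n} (he : e ∉ l) :
    MeasurableSet {d : ℕ → Stub n | firstUnpaired l d = e} := by
  simp only [firstUnpaired_eq_iff he]
  have h : ∀ (j : ℕ) (S : Set (Stub n)), MeasurableSet {d : ℕ → Stub n | d j ∈ S} := fun j S =>
    measurable_pi_apply j MeasurableSet.of_discrete
  have : {d : ℕ → Stub n | ∃ m, (∀ j < m, d j ∈ l) ∧ d m = e} =
      ⋃ m, (⋂ j, ⋂ (_ : j < m), {d | d j ∈ {x | x ∈ l}}) ∩ {d | d m ∈ ({e} : Set (Stub n))} := by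
    ext d
    simp
  rw [this]
  exact MeasurableSet.iUnion fun m => (MeasurableSet.iInter fun j => MeasurableSet.iInter fun _ =>
    h j _).inter (h m _)

/-- Sum over the number m of failed draws: m draws in `l`, then `e`. The geometric series gives the
conditional probability of `e` outside `l`. -/
theorem measure_firstUnpaired {l : List (Stub n)} {e : Stub n} (he : e ∉ l) :
    Measure.infinitePi (fun _ : ℕ => ρ) {d | firstUnpaired l d = e} =
      (1 - ρ {x | x ∈ l})⁻¹ * ρ {e} := by
  set B : ℕ → Set (ℕ → Stub n) := fun m => (Finset.range (m + 1) : Set ℕ).pi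
    fun j => if j < m then {x | x ∈ l} else {e} with hB
  have hmem : ∀ m d, d ∈ B m ↔ (∀ j < m, d j ∈ l) ∧ d m = e := by
    intro m d
    simp only [hB, Set.mem_pi, Finset.coe_range, Set.mem_Iio]
    constructor
    · intro h
      refine ⟨fun j hj => ?_, ?_⟩
      · have := h j (by omega)
        rwa [if_pos hj] at this
      · have := h m (by omega)
        rwa [if_neg (lt_irrefl _)] at this
    · rintro ⟨h1, h2⟩ j hj
      split_ifs with h
      · exact h1 j h
      · have : j = m := by omega
        rw [this]; exact h2
  have hU : {d | firstUnpaired l d = e} = ⋃ m, B m := by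
    ext d
    rw [Set.mem_iUnion]
    simp only [hmem]
    exact firstUnpaired_eq_iff he d
  have hdisj : Pairwise (Function.onFun Disjoint B) := by
    have key : ∀ i j, i < j → Disjoint (B i) (B j) := by
      intro i j hij
      rw [Set.disjoint_left]
      intro d hi hj
      rw [hmem] at hi hj
      exact he (hi.2 ▸ hj.1 i hij)
    intro i j hij
    rcases lt_or_gt_of_ne hij with h | h
    · exact key i j h
    · exact (key j i h).symm
  have hms : ∀ m (j : ℕ), MeasurableSet (if j < m then {x | x ∈ l} else {e} : Set (Stub n)) :=
    fun m j => MeasurableSet.of_discrete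
  rw [hU, measure_iUnion hdisj fun m => MeasurableSet.pi (Finset.countable_toSet _) fun j _ => hms m j]
  have hm : ∀ m, Measure.infinitePi (fun _ : ℕ => ρ) (B m) = ρ {x | x ∈ l} ^ m * ρ {e} := by
    intro m
    rw [hB, Measure.infinitePi_pi _ (fun j _ => hms m j), Finset.prod_range_succ, if_neg (lt_irrefl _)]
    congr 1
    rw [Finset.prod_congr rfl fun j hj => by rw [if_pos (Finset.mem_range.1 hj)]]
    simp
  simp only [hm]
  rw [ENNReal.tsum_mul_right, ENNReal.tsum_geometric]

theorem infinitePi_forall_row (L : ℕ) (E : ℕ → Set (ℕ → Stub n))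
    (hE : ∀ t < L, MeasurableSet (E t)) :
    Measure.infinitePi (fun _ : ℕ × ℕ => ρ) {w | ∀ t < L, (fun m => w (t, m)) ∈ E t} =
      ∏ t ∈ Finset.range L, Measure.infinitePi (fun _ : ℕ => ρ) (E t) := by
  have h := Measure.infinitePi_map_curry (fun _ _ : ℕ => ρ)
  rw [← Measure.infinitePi_pi (fun _ : ℕ => Measure.infinitePi fun _ : ℕ => ρ)
    (s := Finset.range L) (t := E) (fun t ht => hE t (Finset.mem_range.1 ht)), ← h,
    MeasurableEquiv.map_apply]
  congr 1
  ext w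
  simp only [Set.mem_ofPred_eq, Set.mem_preimage, Set.mem_pi, Finset.coe_range, Set.mem_Iio]
  rfl

end Order

/-! ### Every pairing order is equally likely. -/

section Draws

variable {N D : Fin n → ℕ} (root : Fin n)

/-- Replaces the random list of earlier stubs by a prescribed one, which turns the event into a
separate condition on each independent row. -/
theorem forall_pairedStub_eq_iff (w : ℕ × ℕ → Stub n) (e : ℕ → Stub n) (L : ℕ) :
    (∀ t < L, pairedStub N root w t = e t) ↔
      ∀ t < L, firstUnpaired ((List.range t).map e) (fun m => w (t, m)) = e t := by
  have hcongr : ∀ t, (∀ s < t, pairedStub N root w s = e s) →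
      pairedStub N root w t = firstUnpaired ((List.range t).map e) fun m => w (t, m) := by
    intro t h
    rw [pairedStub_eq, List.map_congr_left fun s hs => h s (List.mem_range.1 hs)]
  constructor
  · intro h t ht
    rw [← hcongr t fun s hs => h s (hs.trans ht), h t ht]
  · intro h t
    induction t using Nat.strong_induction_on with
    | _ t ih =>
      intro ht
      rw [hcongr t fun s hs => ih s hs (hs.trans ht), h t ht]

theorem prod_inv_one_sub_div_mul {L : ℕ} :
    ∏ t ∈ Finset.range L, ((1 - (t : ℝ≥0∞) * (L : ℝ≥0∞)⁻¹)⁻¹ * (L : ℝ≥0∞)⁻¹) =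
      ((L.factorial : ℕ) : ℝ≥0∞)⁻¹ := by
  have h : ∀ t ∈ Finset.range L, (1 - (t : ℝ≥0∞) * (L : ℝ≥0∞)⁻¹)⁻¹ * (L : ℝ≥0∞)⁻¹ =
      (((L - 1 - t + 1 : ℕ) : ℝ≥0∞))⁻¹ := by
    intro t ht
    have ht := Finset.mem_range.1 ht
    have hL : (L : ℝ≥0∞) ≠ 0 := by
      have : L ≠ 0 := by omega
      exact_mod_cast this
    have hL' : (L : ℝ≥0∞) ≠ ⊤ := ENNReal.natCast_ne_top _
    rw [← ENNReal.mul_inv (Or.inr hL') (Or.inr hL), ENNReal.sub_mul (fun _ _ => hL'), one_mul,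
      mul_assoc, ENNReal.inv_mul_cancel hL hL', mul_one, show L - 1 - t + 1 = L - t by omega,
      ENNReal.natCast_sub]
  rw [Finset.prod_congr rfl h, Finset.prod_range_reflect (fun j => (((j + 1 : ℕ) : ℝ≥0∞))⁻¹) L,
    ← Finset.prod_range_add_one_eq_factorial, Nat.cast_prod, ENNReal.prod_inv_distrib]
  intro i _ j _ _
  right
  exact ENNReal.natCast_ne_top _

theorem notMem_map_stubSeq {L : ℕ} (q : Fin L ≃ OutStub D) {t : ℕ} (ht : t < L) :
    stubSeq root q t ∉ (List.range t).map (stubSeq root q) := by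
  intro h
  obtain ⟨s, hs, hst⟩ := List.mem_map.1 h
  have hs := List.mem_range.1 hs
  rw [stubSeq, stubSeq, dif_pos ht, dif_pos (hs.trans ht)] at hst
  have := congrArg Fin.val (q.injective (OutStub.toStub_injective hst))
  simp only at this
  omega

theorem stubLaw_map_stubSeq (hD : 0 < ∑ i, D i) {L : ℕ} (q : Fin L ≃ OutStub D) {t : ℕ}
    (ht : t < L) :
    stubLaw D root {x | x ∈ (List.range t).map (stubSeq root q)} =
      t * ((∑ i, D i : ℕ) : ℝ≥0∞)⁻¹ := by
  classical
  have : {x | x ∈ (List.range t).map (stubSeq root q)} =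
      (((Finset.range t).image (stubSeq root q) : Finset (Stub n)) : Set (Stub n)) := by
    ext x
    simp
  rw [this, ← sum_measure_singleton, Finset.sum_image]
  · have : ∀ s ∈ Finset.range t, stubLaw D root {stubSeq root q s} =
        ((∑ i, D i : ℕ) : ℝ≥0∞)⁻¹ := by
      intro s hs
      have hs := Finset.mem_range.1 hs
      rw [stubSeq, dif_pos (hs.trans ht), stubLaw_toStub root hD]
    rw [Finset.sum_congr rfl this]
    simp
  · intro s hs s' hs' h
    have hs := Finset.mem_range.1 hs
    have hs' := Finset.mem_range.1 hs'
    rw [stubSeq, stubSeq, dif_pos (hs.trans ht), dif_pos (hs'.trans ht)] at h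
    simpa using q.injective (OutStub.toStub_injective h)

/-- The law of the array of draws. -/
noncomputable abbrev drawLaw (D : Fin n → ℕ) (root : Fin n) : Measure (ℕ × ℕ → Stub n) :=
  Measure.infinitePi fun _ => stubLaw D root

theorem setOf_pairedStub_eq {L : ℕ} (q : Fin L ≃ OutStub D) :
    {w | ∀ t < L, pairedStub N root w t = stubSeq root q t} =
      {w | ∀ t < L, (fun m => w (t, m)) ∈ {d | firstUnpaired ((List.range t).map (stubSeq root q)) d =
        stubSeq root q t}} := by
  ext w
  exact forall_pairedStub_eq_iff root w _ L

theorem measurableSet_pairedStub {L : ℕ} (q : Fin L ≃ OutStub D) :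
    MeasurableSet {w | ∀ t < L, pairedStub N root w t = stubSeq root q t} := by
  rw [setOf_pairedStub_eq]
  have : {w : ℕ × ℕ → Stub n | ∀ t < L, (fun m => w (t, m)) ∈
      {d | firstUnpaired ((List.range t).map (stubSeq root q)) d = stubSeq root q t}} =
      ⋂ t, ⋂ (_ : t < L), (fun (w : ℕ × ℕ → Stub n) m => w (t, m)) ⁻¹'
        {d | firstUnpaired ((List.range t).map (stubSeq root q)) d = stubSeq root q t} := by
    ext w
    simp
  rw [this]
  refine MeasurableSet.iInter fun t => MeasurableSet.iInter fun ht => ?_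
  have hm : Measurable fun (w : ℕ × ℕ → Stub n) (m : ℕ) => w (t, m) :=
    measurable_pi_lambda _ fun m => measurable_pi_apply _
  exact hm (measurableSet_firstUnpaired (notMem_map_stubSeq root q ht))

/-- Step t is uniform over the L - t stubs that remain, so its factor is 1/(L - t). -/
theorem drawLaw_pairedStub_eq {L : ℕ} (hL : ∑ i, D i = L) (q : Fin L ≃ OutStub D) :
    drawLaw D root {w | ∀ t < L, pairedStub N root w t = stubSeq root q t} =
      ((L.factorial : ℕ) : ℝ≥0∞)⁻¹ := by
  rw [setOf_pairedStub_eq, infinitePi_forall_row _ L _ fun t ht =>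
    measurableSet_firstUnpaired (notMem_map_stubSeq root q ht), ← prod_inv_one_sub_div_mul]
  refine Finset.prod_congr rfl fun t ht => ?_
  have ht := Finset.mem_range.1 ht
  have hD : 0 < ∑ i, D i := by omega
  rw [measure_firstUnpaired _ (notMem_map_stubSeq root q ht), stubLaw_map_stubSeq root hD q ht]
  conv_lhs => rw [stubSeq, dif_pos ht, stubLaw_toStub root hD]
  rw [hL]

/-- The law of the graph does not depend on the root from which it is explored: it is the graph of a
uniformly random matching. -/
theorem drawLaw_edges_le (hND : ∑ i, N i = ∑ i, D i) (S : Set (Fin n → Fin n → ℕ)) :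
    drawLaw D root {w | edges N root w ∈ S} ≤
      (((∑ i, N i).factorial : ℕ) : ℝ≥0∞)⁻¹ *
        ∑ m : InStub N ≃ OutStub D, S.indicator 1 (matchEdges m) := by
  classical
  set L := ∑ i, N i with hL
  set E : (Fin L ≃ OutStub D) → Set (ℕ × ℕ → Stub n) := fun q =>
    {w | ∀ t < L, pairedStub N root w t = stubSeq root q t} with hE
  have hEm : ∀ q, MeasurableSet (E q) := fun q => measurableSet_pairedStub root q
  have hEP : ∀ q, drawLaw D root (E q) = ((L.factorial : ℕ) : ℝ≥0∞)⁻¹ := fun q =>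
    drawLaw_pairedStub_eq root hND.symm q
  have hdisj : Pairwise (Function.onFun Disjoint E) := by
    intro q q' hq
    rw [Function.onFun, Set.disjoint_left]
    intro w h h'
    refine hq (Equiv.ext fun t => OutStub.toStub_injective ?_)
    rw [← stubSeq_fin root, ← stubSeq_fin root, ← h t t.2, ← h' t t.2]
  have hcard : Fintype.card (Fin L ≃ OutStub D) = L.factorial := by
    rw [Fintype.card_equiv (Fintype.equivOfCardEq (by simp [hND]) : Fin L ≃ OutStub D),
      Fintype.card_fin]
  have hfac : ((L.factorial : ℕ) : ℝ≥0∞) ≠ 0 := by exact_mod_cast L.factorial_ne_zero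
  -- There are L! disjoint events of probability 1/L!. The complement, where redraws may fail
  -- forever, is therefore null.
  have htot : drawLaw D root (⋃ q, E q) = 1 := by
    rw [measure_iUnion hdisj hEm, tsum_fintype]
    simp only [hEP, Finset.sum_const, Finset.card_univ, hcard, nsmul_eq_mul]
    exact ENNReal.mul_inv_cancel hfac (ENNReal.natCast_ne_top _)
  have hnull : drawLaw D root (⋃ q, E q)ᶜ = 0 := by
    rw [prob_compl_eq_zero_iff (MeasurableSet.iUnion hEm), htot]
  calc drawLaw D root {w | edges N root w ∈ S}
      ≤ drawLaw D root ((⋃ q, if matchEdges (matching root q) ∈ S then E q else ∅) ∪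
          (⋃ q, E q)ᶜ) := by
        refine measure_mono fun w hw => ?_
        by_cases h : w ∈ ⋃ q, E q
        · left
          obtain ⟨q, hq⟩ := Set.mem_iUnion.1 h
          refine Set.mem_iUnion.2 ⟨q, ?_⟩
          have : edges N root w ∈ S := hw
          rw [edges_eq_matchEdges root hq] at this
          rwa [if_pos this]
        · exact Or.inr h
    _ ≤ ∑ q : Fin L ≃ OutStub D, ((L.factorial : ℕ) : ℝ≥0∞)⁻¹ *
          S.indicator 1 (matchEdges (matching root q)) := by
        refine (measure_union_le _ _).trans ?_
        rw [hnull, add_zero]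
        refine (measure_iUnion_fintype_le _ _).trans (Finset.sum_le_sum fun q _ => ?_)
        split_ifs with h
        · rw [hEP, Set.indicator_of_mem h, Pi.one_apply, mul_one]
        · simp
    _ = _ := by
        rw [← Finset.mul_sum]
        congr 1
        exact (matching_bijective root hND).sum_comp
          (g := fun m : InStub N ≃ OutStub D => S.indicator (1 : (Fin n → Fin n → ℕ) → ℝ≥0∞) (matchEdges m))

end Draws

/-! ### Power iteration -/

/-- PageRank after `k` iterations started at the constant `r₀`. -/
noncomputable def powerRank (c r₀ : ℝ) (M : Matrix (Fin n) (Fin n) ℝ) : ℕ → Fin n → ℝ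
  | 0 => fun _ => r₀
  | k + 1 => Matrix.vecMul (powerRank c r₀ M k) M + fun _ => 1 - c

/-- Bounded row sums contract the ℓ¹ norm because the vector multiplies from the left. -/
theorem sum_abs_vecMul_le {M : Matrix (Fin n) (Fin n) ℝ} {c : ℝ} (hM : ∀ i j, 0 ≤ M i j)
    (hrow : ∀ i, ∑ j, M i j ≤ c) (x : Fin n → ℝ) :
    ∑ j, |Matrix.vecMul x M j| ≤ c * ∑ i, |x i| := by
  calc ∑ j, |Matrix.vecMul x M j| ≤ ∑ j, ∑ i, |x i| * M i j := by
        refine Finset.sum_le_sum fun j _ => ?_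
        simp only [Matrix.vecMul, dotProduct]
        refine (Finset.abs_sum_le_sum_abs _ _).trans (le_of_eq ?_)
        exact Finset.sum_congr rfl fun i _ => by rw [abs_mul, abs_of_nonneg (hM i j)]
    _ = ∑ i, |x i| * ∑ j, M i j := by
        rw [Finset.sum_comm]
        simp only [Finset.mul_sum]
    _ ≤ ∑ i, |x i| * c := by
        gcongr with i
        exact hrow i
    _ = _ := by rw [← Finset.sum_mul, mul_comm]

/-- The fixed-point equation gives ‖R‖₁ ≤ c‖R‖₁ + n(1 - c), so ‖R‖₁ ≤ n and the initial error is at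
most n(1 + r₀); each iteration then gains a factor c. -/
theorem sum_abs_pageRank_sub_powerRank_le {M : Matrix (Fin n) (Fin n) ℝ} {c r₀ : ℝ} (hc : 0 < c)
    (hc' : c < 1) (hr₀ : 0 ≤ r₀) (hM : ∀ i j, 0 ≤ M i j) (hrow : ∀ i, ∑ j, M i j ≤ c) (k : ℕ) :
    ∑ i, |pageRank c M i - powerRank c r₀ M k i| ≤ n * ((r₀ + 1) * c ^ k) := by
  set R := pageRank c M with hR
  have hfix : R = Matrix.vecMul R M + fun _ => 1 - c := by
    refine (eq_pageRank_iff c M (fun i => ?_) R).1 rfl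
    simp only [abs_of_nonneg (hM _ _)]
    exact (hrow i).trans_lt hc'
  have hnorm : ∑ i, |R i| ≤ n := by
    have h1 : ∑ i, |R i| ≤ c * ∑ i, |R i| + n * (1 - c) := by
      calc ∑ i, |R i| = ∑ i, |Matrix.vecMul R M i + (1 - c)| :=
            Finset.sum_congr rfl fun i _ => congrArg abs (congrFun hfix i)
        _ ≤ ∑ i, (|Matrix.vecMul R M i| + (1 - c)) := by
            refine Finset.sum_le_sum fun i _ => (abs_add_le _ _).trans ?_
            rw [abs_of_nonneg (by linarith : 0 ≤ 1 - c)]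
        _ = ∑ i, |Matrix.vecMul R M i| + n * (1 - c) := by
            simp [Finset.sum_add_distrib, mul_sub]
        _ ≤ _ := by
            gcongr
            exact sum_abs_vecMul_le hM hrow R
    nlinarith
  induction k with
  | zero =>
    calc ∑ i, |R i - r₀| ≤ ∑ i, (|R i| + r₀) := by
          refine Finset.sum_le_sum fun i _ => (abs_sub _ _).trans ?_
          rw [abs_of_nonneg hr₀]
      _ = ∑ i, |R i| + n * r₀ := by simp [Finset.sum_add_distrib]
      _ ≤ n * ((r₀ + 1) * c ^ 0) := by
          rw [pow_zero]
          linarith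
  | succ k ih =>
    calc ∑ i, |R i - powerRank c r₀ M (k + 1) i|
        = ∑ i, |Matrix.vecMul (R - powerRank c r₀ M k) M i| := by
          refine Finset.sum_congr rfl fun i _ => ?_
          conv_lhs => rw [hfix]
          simp [powerRank, Matrix.sub_vecMul]
      _ ≤ c * ∑ i, |(R - powerRank c r₀ M k) i| := sum_abs_vecMul_le hM hrow _
      _ ≤ c * (n * ((r₀ + 1) * c ^ k)) := by
          gcongr
          exact ih
      _ = _ := by ring

/-- The matrix of a graph with `e i j` edges from `i` to `j`. -/
noncomputable def edgeMatrix (c : ℝ) (D : Fin n → ℕ) (e : Fin n → Fin n → ℕ) :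
    Matrix (Fin n) (Fin n) ℝ :=
  Matrix.of fun i j => (e i j : ℝ) * c / (D i : ℝ)

theorem sum_matchEdges {N D : Fin n → ℕ} (m : InStub N ≃ OutStub D) (i : Fin n) :
    ∑ j, matchEdges m i j = D i := by
  classical
  have h1 : ∑ j, matchEdges m i j =
      (Finset.univ.filter fun a : InStub N => (m a).1 = i).card := by
    rw [Finset.card_eq_sum_card_fiberwise (f := fun a : InStub N => a.1) (t := Finset.univ)
      fun _ _ => Finset.mem_coe.2 (Finset.mem_univ _)]
    simp only [matchEdges, Finset.filter_filter]
  have h2 : (Finset.univ.filter fun a : InStub N => (m a).1 = i).card =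
      (Finset.univ.filter fun e : OutStub D => e.1 = i).card :=
    Finset.card_equiv m (by simp)
  have h3 : (Finset.univ.filter fun e : OutStub D => e.1 = i).card =
      (Finset.univ : Finset (Fin (D i))).card := by
    symm
    refine Finset.card_bij (fun b _ => ⟨i, b⟩) (by simp) (by simp) ?_
    rintro ⟨j, b⟩ h
    obtain rfl : j = i := by simpa using h
    exact ⟨b, Finset.mem_univ _, rfl⟩
  rw [h1, h2, h3, Finset.card_univ, Fintype.card_fin]

theorem sum_edgeMatrix_matchEdges_le {N D : Fin n → ℕ} {c : ℝ} (hc : 0 < c)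
    (m : InStub N ≃ OutStub D) (i : Fin n) : ∑ j, edgeMatrix c D (matchEdges m) i j ≤ c := by
  have h : ∑ j, edgeMatrix c D (matchEdges m) i j = (D i : ℝ) * c / D i := by
    conv_rhs => rw [← sum_matchEdges m i]
    push_cast
    simp only [edgeMatrix, Matrix.of_apply, Finset.sum_mul, Finset.sum_div, ← sum_matchEdges m i]
    push_cast
    rfl
  rw [h]
  rcases Nat.eq_zero_or_pos (D i) with h0 | h0
  · simp [h0, hc.le]
  · have : (D i : ℝ) ≠ 0 := by exact_mod_cast h0.ne'
    rw [mul_div_cancel_left₀ _ this]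

/-- With the graph law replaced by the uniform matching, which does not involve the root, the sums
over roots and matchings can be exchanged; for a fixed matching the claim is Markov's inequality
over the nodes. -/
theorem sum_drawLaw_pageRank_sub_powerRank_le {N D : Fin n → ℕ} (hND : ∑ i, N i = ∑ i, D i)
    {c r₀ ε : ℝ} (hc : 0 < c) (hc' : c < 1) (hr₀ : 0 ≤ r₀) (hε : 0 < ε) (k : ℕ) :
    ∑ r, drawLaw D r {w | ε < |pageRank c (prMatrix c N D r w) r -
        powerRank c r₀ (prMatrix c N D r w) k r|} ≤
      n * ENNReal.ofReal ((r₀ + 1) * ε⁻¹ * c ^ k) := by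
  classical
  set S : Fin n → Set (Fin n → Fin n → ℕ) := fun r =>
    {e | ε < |pageRank c (edgeMatrix c D e) r - powerRank c r₀ (edgeMatrix c D e) k r|} with hS
  have hm : ∀ m : InStub N ≃ OutStub D, ∑ r, (S r).indicator (1 : (Fin n → Fin n → ℕ) → ℝ≥0∞) (matchEdges m) ≤
      ENNReal.ofReal (n * ((r₀ + 1) * ε⁻¹ * c ^ k)) := by
    intro m
    set M := edgeMatrix c D (matchEdges m) with hM
    have hb := sum_abs_pageRank_sub_powerRank_le hc hc' hr₀ (M := M)
      (fun i j => by simp only [hM, edgeMatrix, Matrix.of_apply]; positivity)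
      (sum_edgeMatrix_matchEdges_le hc m) k
    calc ∑ r, (S r).indicator (1 : (Fin n → Fin n → ℕ) → ℝ≥0∞) (matchEdges m)
        ≤ ∑ r, ENNReal.ofReal (|pageRank c M r - powerRank c r₀ M k r| * ε⁻¹) := by
          refine Finset.sum_le_sum fun r _ => ?_
          by_cases h : matchEdges m ∈ S r
          · rw [Set.indicator_of_mem h, Pi.one_apply, ENNReal.one_le_ofReal, ← div_eq_mul_inv,
              one_le_div hε]
            exact le_of_lt h
          · rw [Set.indicator_of_notMem h]
            exact zero_le
      _ = ENNReal.ofReal (∑ r, |pageRank c M r - powerRank c r₀ M k r| * ε⁻¹) :=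
          (ENNReal.ofReal_sum_of_nonneg fun r _ => by positivity).symm
      _ ≤ _ := by
          apply ENNReal.ofReal_le_ofReal
          rw [← Finset.sum_mul]
          calc _ ≤ n * ((r₀ + 1) * c ^ k) * ε⁻¹ := by gcongr
            _ = _ := by ring
  have hfac : ((((∑ i, N i).factorial : ℕ)) : ℝ≥0∞) ≠ 0 := by
    exact_mod_cast Nat.factorial_ne_zero _
  have hcard : Fintype.card (InStub N ≃ OutStub D) = (∑ i, N i).factorial := by
    rw [Fintype.card_equiv (Fintype.equivOfCardEq (by simp [hND]) : InStub N ≃ OutStub D)]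
    simp
  calc _ ≤ ∑ r, (((∑ i, N i).factorial : ℕ) : ℝ≥0∞)⁻¹ *
        ∑ m : InStub N ≃ OutStub D, (S r).indicator 1 (matchEdges m) :=
        Finset.sum_le_sum fun r _ => drawLaw_edges_le r hND (S r)
    _ = (((∑ i, N i).factorial : ℕ) : ℝ≥0∞)⁻¹ *
        ∑ m : InStub N ≃ OutStub D, ∑ r, (S r).indicator 1 (matchEdges m) := by
        rw [← Finset.mul_sum, Finset.sum_comm]
    _ ≤ (((∑ i, N i).factorial : ℕ) : ℝ≥0∞)⁻¹ *
        ∑ m : InStub N ≃ OutStub D, ENNReal.ofReal (n * ((r₀ + 1) * ε⁻¹ * c ^ k)) := by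
        gcongr with m
        exact hm m
    _ = n * ENNReal.ofReal ((r₀ + 1) * ε⁻¹ * c ^ k) := by
        rw [Finset.sum_const, Finset.card_univ, hcard, nsmul_eq_mul, ← mul_assoc,
          ENNReal.inv_mul_cancel hfac (ENNReal.natCast_ne_top _), one_mul,
          ENNReal.ofReal_mul (by positivity), ENNReal.ofReal_natCast]

/-! ### The coupling of the graph with the tree -/

/-- The number of individuals in the first `k` generations of the tree, the root being generation
`0`. -/
def treeSize (N : Fin n → ℕ) (root : Fin n) (w : ℕ × ℕ → Stub n) : ℕ → ℕ
  | 0 => 1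
  | k + 1 => 1 + ∑ s ∈ Finset.range (treeSize N root w k), N (copyOf root w s)

section Coupling

variable {N D : Fin n → ℕ} {root : Fin n} {w : ℕ × ℕ → Stub n}

theorem treeSize_mono : Monotone (treeSize N root w) := by
  refine monotone_nat_of_le_succ fun k => ?_
  induction k with
  | zero => exact Nat.le_add_right _ _
  | succ k ih =>
    simp only [treeSize] at ih ⊢
    gcongr

/-- If t + 1 individuals have at most t children in all, the tree ends there. So while the tree has
further individuals, the explored part of the graph is not exhausted. -/
theorem treeSize_le_of_sum_le {t : ℕ}
    (h : ∑ s ∈ Finset.range (t + 1), N (copyOf root w s) ≤ t) (k : ℕ) :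
    treeSize N root w k ≤ t + 1 := by
  induction k with
  | zero => simp [treeSize]
  | succ k ih =>
    have : ∑ s ∈ Finset.range (treeSize N root w k), N (copyOf root w s) ≤
        ∑ s ∈ Finset.range (t + 1), N (copyOf root w s) :=
      Finset.sum_le_sum_of_subset (Finset.range_subset_range.2 ih)
    simp only [treeSize]
    omega

theorem length_inbound_map_copyOf (s : ℕ) :
    (inbound N ((List.range s).map (copyOf root w))).length =
      ∑ r ∈ Finset.range s, N (copyOf root w r) := by
  rw [length_inbound, List.map_map]
  induction s with
  | zero => simp
  | succ s ih => rw [List.range_succ, List.map_append, List.sum_append, ih, Finset.sum_range_succ]; simp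

theorem firstUnpaired_eq_zero {l : List (Stub n)} {d : ℕ → Stub n} (h : d 0 ∉ l) :
    firstUnpaired l d = d 0 :=
  (firstUnpaired_eq_iff h d).2 ⟨0, by simp, rfl⟩

/-- As long as the individuals of the tree are copies of different nodes, the exploration of the
graph follows the tree. -/
theorem exploration_eq_tree {k : ℕ}
    (hinj : Set.InjOn (copyOf root w) (Set.Iio (treeSize N root w k))) (t : ℕ)
    (ht : t < treeSize N root w k) :
    nodesAfter N root (pairedStub N root w) t = (List.range (t + 1)).map (copyOf root w) ∧
      ∀ s < t, pairedStub N root w s = w (s, 0) := by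
  induction t with
  | zero => simp [nodesAfter, copyOf]
  | succ t ih =>
    obtain ⟨hn, hq⟩ := ih (by omega)
    have hext : extend N t ((List.range (t + 1)).map (copyOf root w)) =
        (List.range (t + 1)).map (copyOf root w) := by
      rw [extend, if_neg]
      intro hle
      rw [length_inbound_map_copyOf] at hle
      have := treeSize_le_of_sum_le hle k
      omega
    -- A first draw that is already paired would make individual t + 1 a copy of the same node as an
    -- earlier individual.
    have hqt : pairedStub N root w t = w (t, 0) := by
      rw [pairedStub_eq]
      refine firstUnpaired_eq_zero (d := fun m => w (t, m)) fun hmem => ?_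
      obtain ⟨s, hs, hst⟩ := List.mem_map.1 hmem
      have hs := List.mem_range.1 hs
      rw [hq s hs] at hst
      have : s + 1 = t + 1 := hinj (Set.mem_Iio.2 (by omega)) (Set.mem_Iio.2 ht)
        (congrArg Prod.fst hst)
      omega
    refine ⟨?_, fun s hs => ?_⟩
    · simp only [nodesAfter]
      rw [hn, hext, hqt, if_neg]
      · rw [List.range_succ (n := t + 1), List.map_append]
        rfl
      · intro hmem
        obtain ⟨s, hs, hst⟩ := List.mem_map.1 hmem
        have hs := List.mem_range.1 hs
        have : s = t + 1 := hinj (Set.mem_Iio.2 (by omega)) (Set.mem_Iio.2 ht) hst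
        omega
    · rcases Nat.lt_succ_iff_lt_or_eq.1 hs with h | rfl
      · exact hq s h
      · exact hqt

/-- The parents are copies of distinct nodes, so their offspring are at most all inbound stubs. This
places the tree within the range of the exploration. -/
theorem treeSize_le_sum {k : ℕ}
    (hinj : Set.InjOn (copyOf root w) (Set.Iio (treeSize N root w k))) :
    treeSize N root w k ≤ 1 + ∑ i, N i := by
  cases k with
  | zero => simp [treeSize]
  | succ k =>
    conv_lhs => rw [treeSize]
    gcongr
    rw [← Finset.sum_image (f := N) (g := copyOf root w)]
    · exact Finset.sum_le_univ_sum_of_nonneg fun _ => Nat.zero_le _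
    · refine hinj.mono fun s hs => ?_
      have : s < treeSize N root w k := by simpa using hs
      exact Set.mem_Iio.2 (this.trans_le (treeSize_mono (Nat.le_succ k)))

theorem filter_inbound_eq_Ico {u u' : List (Fin n)} {j : Fin n} (root : Fin n)
    (hv : (u ++ j :: u').Nodup) :
    ((Finset.range (inbound N (u ++ j :: u')).length).filter fun t =>
      (inbound N (u ++ j :: u')).getD t root = j) =
      Finset.Ico (inbound N u).length ((inbound N u).length + N j) := by
  have hnot : ∀ {v : List (Fin n)}, j ∉ v → j ∉ inbound N v := by
    intro v hj h
    simp only [inbound, List.mem_flatMap, List.mem_replicate] at h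
    obtain ⟨i, hi, _, rfl⟩ := h
    exact hj hi
  have hu : j ∉ inbound N u := hnot fun h => by
    have := List.disjoint_of_nodup_append hv h
    simp at this
  have hu' : j ∉ inbound N u' := hnot (List.nodup_cons.1 hv.of_append_right).1
  have hsplit : inbound N (u ++ j :: u') =
      inbound N u ++ (List.replicate (N j) j ++ inbound N u') := by
    simp [inbound]
  rw [hsplit]
  set a := inbound N u
  set b := inbound N u'
  ext t
  simp only [Finset.mem_filter, Finset.mem_range, Finset.mem_Ico, List.length_append,
    List.length_replicate]
  rcases lt_or_ge t a.length with h1 | h1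
  · rw [List.getD_append _ _ _ _ h1, List.getD_eq_getElem _ _ h1]
    constructor
    · rintro ⟨_, h⟩
      exact absurd (h ▸ List.getElem_mem h1) hu
    · omega
  · rw [List.getD_append_right _ _ _ _ h1]
    rcases lt_or_ge (t - a.length) (N j) with h2 | h2
    · rw [List.getD_append _ _ _ _ (by simpa using h2), List.getD_eq_getElem _ _ (by simpa using h2),
        List.getElem_replicate]
      simp only [and_true]
      omega
    · rw [List.getD_append_right _ _ _ _ (by simpa using h2), List.length_replicate]
      constructor
      · rintro ⟨h3, h⟩
        have h4 : t - a.length - N j < b.length := by omega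
        rw [List.getD_eq_getElem _ _ h4] at h
        exact absurd (h ▸ List.getElem_mem h4) hu'
      · omega

theorem vecMul_prMatrix (c : ℝ) (x : Fin n → ℝ) (j : Fin n) :
    Matrix.vecMul x (prMatrix c N D root w) j =
      ∑ t ∈ (Finset.range (∑ i, N i)).filter fun t =>
        (inbound N (nodesAfter N root (pairedStub N root w) (∑ i, N i))).getD t root = j,
        c / (D (pairedStub N root w t).1 : ℝ) * x (pairedStub N root w t).1 := by
  rw [← Finset.sum_fiberwise _ fun t => (pairedStub N root w t).1]
  simp only [Matrix.vecMul, dotProduct, prMatrix, Matrix.of_apply]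
  refine Finset.sum_congr rfl fun i _ => ?_
  rw [Finset.sum_congr rfl fun t ht => by rw [(Finset.mem_filter.1 ht).2], Finset.sum_const,
    edges_eq_card, Finset.filter_filter, nsmul_eq_mul]
  simp only [and_comm]
  ring

/-- The inbound stubs of one node are a block of consecutive steps starting at the number of
children of earlier individuals. These steps are precisely the ones that bear its children in the
tree, so its in-neighbours, with multiplicity, are the copied nodes. -/
theorem vecMul_prMatrix_copyOf {k g s : ℕ}
    (hinj : Set.InjOn (copyOf root w) (Set.Iio (treeSize N root w k))) (hg : g < k)
    (hs : s < treeSize N root w g) (c : ℝ) (x : Fin n → ℝ) :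
    Matrix.vecMul x (prMatrix c N D root w) (copyOf root w s) =
      ∑ a ∈ Finset.range (N (copyOf root w s)),
        c / (D (copyOf root w (child N root w s a)) : ℝ) *
          x (copyOf root w (child N root w s a)) := by
  -- After T pairings the node list consists of all T + 1 individuals of the tree.
  obtain ⟨T, hT⟩ : ∃ T, treeSize N root w k = T + 1 :=
    ⟨treeSize N root w k - 1, by
      have := treeSize_mono (N := N) (root := root) (w := w) (Nat.zero_le k)
      simp only [treeSize] at this
      omega⟩
  obtain ⟨hV, hq⟩ := exploration_eq_tree hinj T (by omega)
  have hTL : T ≤ ∑ i, N i := by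
    have := treeSize_le_sum hinj
    omega
  have hsT : s < T + 1 := by
    rw [← hT]
    exact hs.trans_le (treeSize_mono hg.le)
  obtain ⟨rest, hrest⟩ := nodesAfter_prefix N root (pairedStub N root w) hTL
  have hsplit : nodesAfter N root (pairedStub N root w) (∑ i, N i) =
      (List.range s).map (copyOf root w) ++ copyOf root w s ::
        (((List.range' (s + 1) (T - s)).map (copyOf root w)) ++ rest) := by
    rw [← hrest, hV]
    have : List.range (T + 1) = List.range s ++ (s :: List.range' (s + 1) (T - s)) := by
      have h := List.range'_append_1 (s := 0) (m := s) (n := T - s + 1)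
      rw [Nat.zero_add, List.range'_succ, show s + (T - s + 1) = T + 1 by omega] at h
      rw [List.range_eq_range', List.range_eq_range', h]
    rw [this]
    simp
  have hnd := nodup_nodesAfter N root (pairedStub N root w) (∑ i, N i)
  have hlen := length_inbound_nodesAfter N root (pairedStub N root w)
  rw [vecMul_prMatrix]
  rw [hsplit] at hnd hlen ⊢
  conv_lhs => rw [← hlen]
  have hIco := filter_inbound_eq_Ico (N := N) root hnd
  rw [hIco, length_inbound_map_copyOf, Finset.sum_Ico_eq_sum_range, Nat.add_sub_cancel_left]
  refine Finset.sum_congr rfl fun a ha => ?_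
  have ha := Finset.mem_range.1 ha
  have hlt : ∑ r ∈ Finset.range s, N (copyOf root w r) + a < T := by
    have h1 : ∑ r ∈ Finset.range (s + 1), N (copyOf root w r) ≤
        ∑ r ∈ Finset.range (treeSize N root w g), N (copyOf root w r) :=
      Finset.sum_le_sum_of_subset (Finset.range_subset_range.2 hs)
    have h2 : treeSize N root w (g + 1) ≤ treeSize N root w k := treeSize_mono hg
    rw [Finset.sum_range_succ] at h1
    simp only [treeSize] at h2
    omega
  have hchild : (pairedStub N root w (∑ r ∈ Finset.range s, N (copyOf root w r) + a)).1 =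
      copyOf root w (child N root w s a) := by
    rw [hq _ hlt, child, show 1 + ∑ r ∈ Finset.range s, N (copyOf root w r) + a =
      (∑ r ∈ Finset.range s, N (copyOf root w r) + a) + 1 by ring]
    rfl
  rw [hchild]

theorem child_lt_treeSize {g s a : ℕ} (hs : s < treeSize N root w g)
    (ha : a < N (copyOf root w s)) : child N root w s a < treeSize N root w (g + 1) := by
  have h1 : ∑ r ∈ Finset.range (s + 1), N (copyOf root w r) ≤
      ∑ r ∈ Finset.range (treeSize N root w g), N (copyOf root w r) :=
    Finset.sum_le_sum_of_subset (Finset.range_subset_range.2 hs)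
  rw [Finset.sum_range_succ] at h1
  simp only [treeSize, child]
  omega

/-- If the first `k` generations of the tree are copies of different nodes, then PageRank of the
root after `k` iterations is the same in the graph and in the tree. -/
theorem powerRank_root_eq_treeRank {k : ℕ}
    (hinj : Set.InjOn (copyOf root w) (Set.Iio (treeSize N root w k))) (c r₀ : ℝ) :
    powerRank c r₀ (prMatrix c N D root w) k root = treeRank c r₀ N D root w k 0 := by
  have key : ∀ j g s, j + g ≤ k → s < treeSize N root w g →
      powerRank c r₀ (prMatrix c N D root w) j (copyOf root w s) =
        treeRank c r₀ N D root w j s := by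
    intro j
    induction j with
    | zero => intros; rfl
    | succ j ih =>
      intro g s hg hs
      simp only [powerRank, treeRank, Pi.add_apply]
      rw [vecMul_prMatrix_copyOf hinj (by omega) hs, add_comm]
      congr 1
      refine Finset.sum_congr rfl fun a ha => ?_
      rw [ih (g + 1) _ (by omega) (child_lt_treeSize hs (Finset.mem_range.1 ha))]
  exact key k 0 0 (by omega) (by simp [treeSize])

end Coupling

/-! ### The size of the tree -/

section TreeSize

variable {N D : Fin n → ℕ} {root : Fin n}

theorem one_le_treeSize (w : ℕ × ℕ → Stub n) (k : ℕ) : 1 ≤ treeSize N root w k :=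
  treeSize_mono (N := N) (root := root) (w := w) (Nat.zero_le k)

theorem treeSize_eq_of_le {w w' : ℕ × ℕ → Stub n} {s k : ℕ}
    (h : ∀ r < s, copyOf root w r = copyOf root w' r) (hk : treeSize N root w k ≤ s) :
    treeSize N root w' k = treeSize N root w k := by
  induction k with
  | zero => rfl
  | succ k ih =>
    have hle := treeSize_mono (N := N) (root := root) (w := w) (Nat.le_succ k)
    simp only [treeSize]
    rw [ih (hle.trans hk)]
    congr 1
    refine Finset.sum_congr rfl fun r hr => ?_
    rw [h r ((Finset.mem_range.1 hr).trans_le (hle.trans hk))]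

/-- Whether there are more than `s` individuals is determined by the individuals before `s`. -/
theorem lt_treeSize_congr {w w' : ℕ × ℕ → Stub n} {s k : ℕ}
    (h : ∀ r < s, copyOf root w r = copyOf root w' r) :
    s < treeSize N root w k ↔ s < treeSize N root w' k := by
  rw [← not_le, ← not_le, not_iff_not]
  constructor
  · intro hk
    rwa [treeSize_eq_of_le h hk]
  · intro hk
    rwa [treeSize_eq_of_le (fun r hr => (h r hr).symm) hk]

/-- The array of draws with the given first draws for the inbound stubs before `s`. -/
noncomputable def extendDraws (root : Fin n) (S : Finset (ℕ × ℕ)) (v : S → Stub n) :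
    ℕ × ℕ → Stub n := by
  classical exact fun p => if h : p ∈ S then v ⟨p, h⟩ else (root, 0)

/-- The stopping-time property behind Wald's identity: whether individual s + 1 belongs to the first
generations is decided by the draws before s, and is independent of the draw s that determines its
offspring. -/
theorem lt_treeSize_extendDraws (w : ℕ × ℕ → Stub n) (s k : ℕ) :
    s + 1 < treeSize N root w k ↔ s + 1 < treeSize N root
      (extendDraws root (Finset.range s ×ˢ {0}) fun i => w i) k := by
  refine lt_treeSize_congr fun r hr => ?_
  cases r with
  | zero => rfl
  | succ r => simp [copyOf, extendDraws, show r < s by omega]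

theorem measurableSet_lt_treeSize (s k : ℕ) :
    MeasurableSet {w : ℕ × ℕ → Stub n | s + 1 < treeSize N root w k} := by
  have hm : Measurable fun (w : ℕ × ℕ → Stub n) (i : (Finset.range s ×ˢ {0} : Finset (ℕ × ℕ))) =>
    w i := measurable_pi_lambda _ fun i => measurable_pi_apply _
  have := hm (MeasurableSet.of_discrete (s := {v |
    s + 1 < treeSize N root (extendDraws root (Finset.range s ×ˢ {0}) v) k}))
  convert! this using 1
  ext w
  exact lt_treeSize_extendDraws w s k

theorem lintegral_drawLaw_comp_eval (f : Stub n → ℝ≥0∞) (p : ℕ × ℕ) :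
    ∫⁻ w, f (w p) ∂drawLaw D root = ∫⁻ e, f e ∂stubLaw D root :=
  (measurePreserving_eval_infinitePi (fun _ : ℕ × ℕ => stubLaw D root) p).lintegral_comp
    (measurable_of_countable f)

theorem lintegral_indicator_mul (s k : ℕ) (f : Stub n → ℝ≥0∞) :
    ∫⁻ w, {w | s + 1 < treeSize N root w k}.indicator 1 w * f (w (s, 0)) ∂drawLaw D root =
      drawLaw D root {w | s + 1 < treeSize N root w k} * ∫⁻ e, f e ∂stubLaw D root := by
  have hi : iIndepFun (fun (p : ℕ × ℕ) (w : ℕ × ℕ → Stub n) => w p) (drawLaw D root) :=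
    iIndepFun_infinitePi (P := fun _ : ℕ × ℕ => stubLaw D root) (X := fun _ e => e)
      fun _ => measurable_id
  have hind := hi.indepFun_finset (Finset.range s ×ˢ {0}) {(s, 0)} (by simp)
    fun p => measurable_pi_apply p
  have hind' := hind.comp (φ := {v | s + 1 < treeSize N root
      (extendDraws root (Finset.range s ×ˢ {0}) v) k}.indicator (fun _ => (1 : ℝ≥0∞)))
    (ψ := fun v => f (v ⟨(s, 0), by simp⟩)) (measurable_of_countable _) (measurable_of_countable _)
  have hφ : {v | s + 1 < treeSize N root
      (extendDraws root (Finset.range s ×ˢ {0}) v) k}.indicator (fun _ => (1 : ℝ≥0∞)) ∘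
      (fun (w : ℕ × ℕ → Stub n) (i : (Finset.range s ×ˢ {0} : Finset (ℕ × ℕ))) => w i) =
      {w | s + 1 < treeSize N root w k}.indicator 1 := by
    ext w
    simp only [Function.comp_apply, Set.indicator_apply, Set.mem_ofPred_eq,
      ← lt_treeSize_extendDraws, Pi.one_apply]
  rw [hφ] at hind'
  have hmul := lintegral_mul_eq_lintegral_mul_lintegral_of_indepFun''
    (measurable_one.indicator (measurableSet_lt_treeSize s k)).aemeasurable
    ((measurable_of_countable f).comp (measurable_pi_apply (s, 0))).aemeasurable hind'
  refine hmul.trans ?_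
  rw [lintegral_indicator_one (measurableSet_lt_treeSize s k)]
  congr 1
  exact lintegral_drawLaw_comp_eval f (s, 0)

theorem sum_range_eq_tsum_indicator (T : ℕ) (f : ℕ → ℝ≥0∞) :
    ∑ s ∈ Finset.range T, f s = ∑' s, {s | s < T}.indicator f s := by
  have h0 : ∀ s ∉ Finset.range T, {s | s < T}.indicator f s = 0 := fun s hs =>
    Set.indicator_of_notMem (show s ∉ {s | s < T} from fun h => hs (Finset.mem_range.2 h)) _
  rw [tsum_eq_sum h0]
  exact Finset.sum_congr rfl fun s hs =>
    (Set.indicator_of_mem (show s ∈ {s | s < T} from Finset.mem_range.1 hs) _).symm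

theorem natCast_treeSize_sub_one (k : ℕ) (w : ℕ × ℕ → Stub n) :
    ((treeSize N root w k - 1 : ℕ) : ℝ≥0∞) =
      ∑' s, {w | s + 1 < treeSize N root w k}.indicator 1 w := by
  obtain ⟨T, hT⟩ : ∃ T, treeSize N root w k = T + 1 :=
    ⟨treeSize N root w k - 1, by have := one_le_treeSize (N := N) (root := root) w k; omega⟩
  have := sum_range_eq_tsum_indicator T (fun _ => 1)
  simp only [Finset.sum_const, Finset.card_range, nsmul_eq_mul, mul_one] at this
  rw [hT, Nat.add_sub_cancel, this]
  refine tsum_congr fun s => ?_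
  by_cases h : s < T <;> simp [hT, h]

theorem measurable_treeSize_sub_one (k : ℕ) :
    Measurable fun w : ℕ × ℕ → Stub n => ((treeSize N root w k - 1 : ℕ) : ℝ≥0∞) := by
  simp only [natCast_treeSize_sub_one]
  exact Measurable.tsum fun s => measurable_one.indicator (measurableSet_lt_treeSize s k)

/-- Wald's identity for the expected size of the tree. -/
theorem lintegral_treeSize_succ (k : ℕ) :
    ∫⁻ w, ((treeSize N root w (k + 1) - 1 : ℕ) : ℝ≥0∞) ∂drawLaw D root =
      N root + (∫⁻ e, (N e.1 : ℝ≥0∞) ∂stubLaw D root) *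
        ∫⁻ w, ((treeSize N root w k - 1 : ℕ) : ℝ≥0∞) ∂drawLaw D root := by
  have h1 : ∀ w : ℕ × ℕ → Stub n, ((treeSize N root w (k + 1) - 1 : ℕ) : ℝ≥0∞) =
      N root + ∑' s, {w | s + 1 < treeSize N root w k}.indicator 1 w * (N (w (s, 0)).1 : ℝ≥0∞) := by
    intro w
    obtain ⟨T, hT⟩ : ∃ T, treeSize N root w k = T + 1 :=
      ⟨treeSize N root w k - 1, by have := one_le_treeSize (N := N) (root := root) w k; omega⟩
    -- The root is split off: its in-degree is not size-biased, whereas individual s + 1 comes from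
    -- draw s.
    rw [treeSize, hT, Finset.sum_range_succ', Nat.add_sub_cancel_left, add_comm]
    push_cast
    congr 1
    rw [sum_range_eq_tsum_indicator]
    refine tsum_congr fun s => ?_
    by_cases h : s < T <;> simp [hT, h, copyOf]
  have h2 := natCast_treeSize_sub_one (N := N) (root := root) (k := k)
  have hm : ∀ s, Measurable fun w : ℕ × ℕ → Stub n =>
      {w | s + 1 < treeSize N root w k}.indicator (1 : (ℕ × ℕ → Stub n) → ℝ≥0∞) w := fun s =>
    measurable_one.indicator (measurableSet_lt_treeSize s k)
  have hm' : ∀ s, Measurable fun w : ℕ × ℕ → Stub n => (N (w (s, 0)).1 : ℝ≥0∞) := fun s =>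
    (measurable_of_countable fun e : Stub n => (N e.1 : ℝ≥0∞)).comp (measurable_pi_apply (s, 0))
  simp only [h1, h2]
  have hmul : ∀ s, AEMeasurable (fun w : ℕ × ℕ → Stub n =>
      {w | s + 1 < treeSize N root w k}.indicator (1 : (ℕ × ℕ → Stub n) → ℝ≥0∞) w *
        (N (w (s, 0)).1 : ℝ≥0∞)) (drawLaw D root) := fun s => ((hm s).mul (hm' s)).aemeasurable
  rw [lintegral_add_left measurable_const, lintegral_const, measure_univ, mul_one,
    lintegral_tsum hmul, lintegral_tsum fun s => (hm s).aemeasurable, ← ENNReal.tsum_mul_left]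
  congr 1
  refine tsum_congr fun s => ?_
  rw [lintegral_indicator_mul s k fun e => (N e.1 : ℝ≥0∞),
    lintegral_indicator_one (measurableSet_lt_treeSize s k), mul_comm]

/-- Summed over roots, the first generation has ∑N individuals and each further one is multiplied by
at most λ; the partial geometric sum is the fraction. -/
theorem sum_lintegral_treeSize_le {lam : ℝ} (hlam : 1 < lam)
    (hν : ∀ r, ∫⁻ e, (N e.1 : ℝ≥0∞) ∂stubLaw D r ≤ ENNReal.ofReal lam) (k : ℕ) :
    ∑ r, ∫⁻ w, ((treeSize N r w k - 1 : ℕ) : ℝ≥0∞) ∂drawLaw D r ≤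
      ENNReal.ofReal ((∑ i, N i : ℕ) * ((lam ^ k - 1) / (lam - 1))) := by
  induction k with
  | zero => simp [treeSize]
  | succ k ih =>
    have hk : 0 ≤ (lam ^ k - 1) / (lam - 1) :=
      div_nonneg (by linarith [one_le_pow₀ hlam.le (n := k)]) (by linarith)
    calc _ ≤ ∑ r, ((N r : ℝ≥0∞) + ENNReal.ofReal lam *
          ∫⁻ w, ((treeSize N r w k - 1 : ℕ) : ℝ≥0∞) ∂drawLaw D r) := by
          refine Finset.sum_le_sum fun r _ => ?_
          rw [lintegral_treeSize_succ]
          gcongr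
          exact hν r
      _ = ((∑ i, N i : ℕ) : ℝ≥0∞) + ENNReal.ofReal lam *
          ∑ r, ∫⁻ w, ((treeSize N r w k - 1 : ℕ) : ℝ≥0∞) ∂drawLaw D r := by
          rw [Finset.sum_add_distrib, ← Finset.mul_sum, Nat.cast_sum]
      _ ≤ ((∑ i, N i : ℕ) : ℝ≥0∞) + ENNReal.ofReal lam *
          ENNReal.ofReal ((∑ i, N i : ℕ) * ((lam ^ k - 1) / (lam - 1))) := by gcongr
      _ = _ := by
          rw [← ENNReal.ofReal_mul (by linarith), ← ENNReal.ofReal_natCast (∑ i, N i),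
            ← ENNReal.ofReal_add (by positivity) (by positivity)]
          congr 1
          have : lam - 1 ≠ 0 := by linarith
          field_simp
          ring

theorem sum_drawLaw_lt_treeSize_le {lam : ℝ} (hlam : 1 < lam)
    (hν : ∀ r, ∫⁻ e, (N e.1 : ℝ≥0∞) ∂stubLaw D r ≤ ENNReal.ofReal lam) (k : ℕ) {m : ℕ}
    (hm : 1 ≤ m) :
    ∑ r, drawLaw D r {w | m < treeSize N r w k} ≤
      ENNReal.ofReal ((∑ i, N i : ℕ) * (lam ^ k / (lam - 1)) / m) := by
  have hm0 : (m : ℝ≥0∞) ≠ 0 := by exact_mod_cast (by omega : m ≠ 0)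
  have hm' : (0 : ℝ) < m := by exact_mod_cast hm
  calc _ ≤ ∑ r, (∫⁻ w, ((treeSize N r w k - 1 : ℕ) : ℝ≥0∞) ∂drawLaw D r) / m := by
        refine Finset.sum_le_sum fun r _ => ?_
        rw [ENNReal.le_div_iff_mul_le (Or.inl hm0) (Or.inl (ENNReal.natCast_ne_top _)), mul_comm]
        refine le_trans ?_ (mul_meas_ge_le_lintegral₀ ?_ (m : ℝ≥0∞))
        · gcongr with w
          intro hw
          exact_mod_cast (by omega : m ≤ treeSize N r w k - 1)
        · exact (measurable_treeSize_sub_one k).aemeasurable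
    _ ≤ ENNReal.ofReal ((∑ i, N i : ℕ) * ((lam ^ k - 1) / (lam - 1))) / m := by
        simp only [div_eq_mul_inv]
        rw [← Finset.sum_mul]
        gcongr
        exact sum_lintegral_treeSize_le hlam hν k
    _ ≤ _ := by
        rw [ENNReal.ofReal_div_of_pos hm', ENNReal.ofReal_natCast]
        gcongr
        linarith

end TreeSize

/-! ### Repeated draws -/

section Collision

variable {N D : Fin n → ℕ} {root : Fin n}

open Classical in
theorem stubLaw_fst_eq (hD : 0 < ∑ i, D i) (i : Fin n) :
    stubLaw D root {e | e.1 = i} = ENNReal.ofReal ((D i : ℝ) / ∑ j, (D j : ℝ)) := by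
  rw [← lintegral_indicator_one MeasurableSet.of_discrete, lintegral_stubLaw root hD]
  have h : ∑ a : OutStub D, {e : Stub n | e.1 = i}.indicator (1 : Stub n → ℝ≥0∞) a.toStub = D i := by
    rw [Fintype.sum_sigma, Finset.sum_eq_single i]
    · simp [OutStub.toStub]
    · intro j _ hj
      simp [OutStub.toStub, hj]
    · simp
  have hD' : (0 : ℝ) < ∑ j, (D j : ℝ) := by exact_mod_cast hD
  rw [h, ENNReal.ofReal_div_of_pos hD', ENNReal.ofReal_natCast, ← Nat.cast_sum,
    ENNReal.ofReal_natCast, mul_comm, div_eq_mul_inv]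

theorem lintegral_stubLaw_inDegree (hD : 0 < ∑ i, D i) :
    ∫⁻ e, (N e.1 : ℝ≥0∞) ∂stubLaw D root =
      ENNReal.ofReal ((∑ i, (N i : ℝ) * D i) / ∑ j, (D j : ℝ)) := by
  have hD' : (0 : ℝ) < ∑ j, (D j : ℝ) := by exact_mod_cast hD
  have h : ∑ a : OutStub D, (N (OutStub.toStub a).1 : ℝ≥0∞) = ((∑ i, N i * D i : ℕ) : ℝ≥0∞) := by
    rw [Fintype.sum_sigma]
    simp [OutStub.toStub, mul_comm]
  have h2 : (∑ i, (N i : ℝ) * D i) = ((∑ i, N i * D i : ℕ) : ℝ) := by push_cast; rfl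
  rw [lintegral_stubLaw root hD, h, ENNReal.ofReal_div_of_pos hD', h2, ENNReal.ofReal_natCast,
    ← Nat.cast_sum, ENNReal.ofReal_natCast, mul_comm, div_eq_mul_inv]

theorem drawLaw_fst_eq_fst (hD : 0 < ∑ i, D i) {p p' : ℕ × ℕ} (hp : p ≠ p') :
    drawLaw D root {w | (w p).1 = (w p').1} ≤
      ENNReal.ofReal ((∑ i, (D i : ℝ) ^ 2) / (∑ j, (D j : ℝ)) ^ 2) := by
  have h : {w : ℕ × ℕ → Stub n | (w p).1 = (w p').1} ⊆
      ⋃ i, (({p, p'} : Finset (ℕ × ℕ)) : Set (ℕ × ℕ)).pi fun _ => {e : Stub n | e.1 = i} := by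
    intro w hw
    have hw : (w p).1 = (w p').1 := hw
    refine Set.mem_iUnion.2 ⟨(w p').1, ?_⟩
    simp [hw]
  refine (measure_mono h).trans ((measure_iUnion_fintype_le _ _).trans (le_of_eq ?_))
  rw [Finset.sum_div, ENNReal.ofReal_sum_of_nonneg fun i _ => by positivity]
  refine Finset.sum_congr rfl fun i _ => ?_
  rw [Measure.infinitePi_pi _ fun _ _ => MeasurableSet.of_discrete, Finset.prod_pair hp,
    stubLaw_fst_eq hD, ← ENNReal.ofReal_mul (by positivity)]
  congr 1
  rw [div_mul_div_comm, sq, sq]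

theorem drawLaw_fst_eq (hD : 0 < ∑ i, D i) (p : ℕ × ℕ) (i : Fin n) :
    drawLaw D root {w | (w p).1 = i} = ENNReal.ofReal ((D i : ℝ) / ∑ j, (D j : ℝ)) := by
  rw [← stubLaw_fst_eq (root := root) hD]
  exact (measurePreserving_eval_infinitePi (fun _ : ℕ × ℕ => stubLaw D root) p).measure_preimage
    (s := {e | e.1 = i}) MeasurableSet.of_discrete.nullMeasurableSet

/-- A draw hits root r with probability D_r/∑D, which sums to one over the roots, so collisions with
the root cost m in total. The m² pairs of draws cost ∑D²/(∑D)² each, for each of the n roots. -/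
theorem sum_drawLaw_not_injOn_le (hD : 0 < ∑ i, D i) (m : ℕ) :
    ∑ r, drawLaw D r {w | ¬ Set.InjOn (copyOf r w) (Set.Iio m)} ≤
      ENNReal.ofReal (m + n * (m ^ 2 * ((∑ i, (D i : ℝ) ^ 2) / (∑ j, (D j : ℝ)) ^ 2))) := by
  set B := (∑ i, (D i : ℝ) ^ 2) / (∑ j, (D j : ℝ)) ^ 2 with hB
  have hB0 : 0 ≤ B := by positivity
  have hD' : (0 : ℝ) < ∑ j, (D j : ℝ) := by exact_mod_cast hD
  have hr : ∀ r, drawLaw D r {w | ¬ Set.InjOn (copyOf r w) (Set.Iio m)} ≤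
      ENNReal.ofReal (m * ((D r : ℝ) / ∑ j, (D j : ℝ)) + m ^ 2 * B) := by
    intro r
    have hsub : {w : ℕ × ℕ → Stub n | ¬ Set.InjOn (copyOf r w) (Set.Iio m)} ⊆
        (⋃ t ∈ Finset.range m, {w | (w (t, 0)).1 = r}) ∪
        ⋃ x ∈ (Finset.range m ×ˢ Finset.range m).filter fun x => x.1 ≠ x.2,
          {w | (w (x.1, 0)).1 = (w (x.2, 0)).1} := by
      intro w hw
      by_contra hc
      simp only [Set.mem_union, Set.mem_iUnion, Finset.mem_range, Set.mem_ofPred_eq,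
        Finset.mem_filter, Finset.mem_product, not_or, not_exists, Prod.forall] at hc
      obtain ⟨h1, h2⟩ := hc
      refine hw fun s hs t ht hst => ?_
      have hs := Set.mem_Iio.1 hs
      have ht := Set.mem_Iio.1 ht
      cases s with
      | zero =>
        cases t with
        | zero => rfl
        | succ t => exact absurd hst.symm (h1 t (by omega))
      | succ s =>
        cases t with
        | zero => exact absurd hst (h1 s (by omega))
        | succ t =>
          by_contra hne
          exact h2 s t ⟨⟨by omega, by omega⟩, by simpa using fun h => hne (by omega)⟩ hst
    refine (measure_mono hsub).trans ((measure_union_le _ _).trans ?_)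
    rw [ENNReal.ofReal_add (by positivity) (by positivity)]
    refine add_le_add ?_ ?_
    · refine (measure_biUnion_finset_le _ _).trans ?_
      simp only [drawLaw_fst_eq hD]
      rw [Finset.sum_const, Finset.card_range, nsmul_eq_mul, ENNReal.ofReal_mul (by positivity),
        ENNReal.ofReal_natCast]
    · refine (measure_biUnion_finset_le _ _).trans ?_
      calc _ ≤ ∑ x ∈ (Finset.range m ×ˢ Finset.range m).filter fun x => x.1 ≠ x.2,
            ENNReal.ofReal B := by
            refine Finset.sum_le_sum fun x hx => drawLaw_fst_eq_fst hD ?_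
            have := (Finset.mem_filter.1 hx).2
            simpa using this
        _ ≤ ∑ x ∈ Finset.range m ×ˢ Finset.range m, ENNReal.ofReal B :=
            Finset.sum_le_sum_of_subset (Finset.filter_subset _ _)
        _ = _ := by
            rw [Finset.sum_const, Finset.card_product, Finset.card_range, nsmul_eq_mul,
              ENNReal.ofReal_mul (by positivity), ← sq, ENNReal.ofReal_pow (by positivity),
              ENNReal.ofReal_natCast, Nat.cast_pow]
  refine (Finset.sum_le_sum fun r _ => hr r).trans (le_of_eq ?_)
  rw [← ENNReal.ofReal_sum_of_nonneg fun r _ => by positivity]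
  congr 1
  rw [Finset.sum_add_distrib, ← Finset.mul_sum, ← Finset.sum_div, div_self hD'.ne']
  simp

end Collision

/-! ### Conclusion -/

/-- No measurability of S is needed: countably many sections are replaced by measurable hulls of the
same measure. -/
theorem compProd_apply_le {X Y : Type*} [MeasurableSpace X] [MeasurableSpace Y] [Countable X]
    [MeasurableSingletonClass X] (μ : Measure X) [SFinite μ] (κ : Kernel X Y) [IsSFiniteKernel κ]
    (S : Set (X × Y)) : (μ ⊗ₘ κ) S ≤ ∫⁻ x, κ x {y | (x, y) ∈ S} ∂μ := by
  set T : Set (X × Y) := ⋃ x, {x} ×ˢ toMeasurable (κ x) {y | (x, y) ∈ S} with hT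
  have hTm : MeasurableSet T := MeasurableSet.iUnion fun x =>
    (measurableSet_singleton x).prod (measurableSet_toMeasurable _ _)
  have hST : S ⊆ T := by
    rintro ⟨x, y⟩ h
    exact Set.mem_iUnion.2 ⟨x, rfl, subset_toMeasurable _ _ h⟩
  refine (measure_mono hST).trans ?_
  rw [Measure.compProd_apply hTm]
  refine lintegral_mono fun x => ?_
  rw [← measure_toMeasurable {y | (x, y) ∈ S}]
  refine measure_mono fun y hy => ?_
  obtain ⟨x', hx', hy'⟩ := Set.mem_iUnion.1 hy
  obtain rfl : x = x' := hx'
  exact hy'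

theorem lintegral_uniformOn_univ (f : Fin n → ℝ≥0∞) :
    ∫⁻ r, f r ∂uniformOn (Set.univ : Set (Fin n)) = (n : ℝ≥0∞)⁻¹ * ∑ r, f r := by
  rw [uniformOn, ProbabilityTheory.cond, lintegral_smul_measure, Measure.restrict_univ,
    lintegral_count, tsum_fintype, Measure.count_univ]
  simp

/-- The kernel that gives the draws. -/
noncomputable abbrev drawKernel (n : ℕ) : Kernel (BiDegree n × Fin n) (ℕ × ℕ → Stub n) :=
  Kernel.ofFunOfCountable fun y => Measure.infinitePi fun _ : ℕ × ℕ => stubLaw y.1.2 y.2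

instance (n : ℕ) : IsMarkovKernel (drawKernel n) :=
  ⟨fun y => inferInstanceAs (IsProbabilityMeasure (drawLaw y.1.2 y.2))⟩

theorem isProbabilityMeasure_uniformOn_univ (hn : 1 ≤ n) :
    IsProbabilityMeasure (uniformOn (Set.univ : Set (Fin n))) :=
  isProbabilityMeasure_uniformOn Set.finite_univ ⟨⟨0, hn⟩, Set.mem_univ _⟩

section Law

variable {Fi Fo : Measure ℕ} {α β δ₀ : ℝ}

theorem isProbabilityMeasure_law [IsProbabilityMeasure (biDegreeLaw Fi Fo α β δ₀ n)] (hn : 1 ≤ n) :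
    IsProbabilityMeasure (law Fi Fo α β δ₀ n) := by
  have := isProbabilityMeasure_uniformOn_univ hn
  exact inferInstanceAs (IsProbabilityMeasure
    (((biDegreeLaw Fi Fo α β δ₀ n).prod (uniformOn (Set.univ : Set (Fin n)))) ⊗ₘ drawKernel n))

/-- The uniform root turns a sum over roots into n times a probability; bad degree sequences are
charged in full. -/
theorem law_le [IsProbabilityMeasure (biDegreeLaw Fi Fo α β δ₀ n)] (hn : 1 ≤ n)
    (S : Set (Sample n)) (G : Set (BiDegree n)) (ρ : ℝ≥0∞)
    (hS : ∀ x ∈ G, ∑ r, drawLaw x.2 r {w | ((x, r), w) ∈ S} ≤ n * ρ) :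
    law Fi Fo α β δ₀ n S ≤ ρ + biDegreeLaw Fi Fo α β δ₀ n Gᶜ := by
  have := isProbabilityMeasure_uniformOn_univ hn
  have hn0 : (n : ℝ≥0∞) ≠ 0 := by exact_mod_cast (by omega : n ≠ 0)
  refine (compProd_apply_le ((biDegreeLaw Fi Fo α β δ₀ n).prod
    (uniformOn (Set.univ : Set (Fin n)))) (drawKernel n) S).trans ?_
  rw [lintegral_prod _ (measurable_of_countable _).aemeasurable]
  calc _ ≤ ∫⁻ x, (ρ + Gᶜ.indicator 1 x) ∂biDegreeLaw Fi Fo α β δ₀ n := by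
        refine lintegral_mono fun x => ?_
        by_cases hx : x ∈ G
        · refine le_trans ?_ le_self_add
          rw [lintegral_uniformOn_univ]
          calc _ ≤ (n : ℝ≥0∞)⁻¹ * (n * ρ) := by
                gcongr
                exact hS x hx
            _ = ρ := by
                rw [← mul_assoc, ENNReal.inv_mul_cancel hn0 (ENNReal.natCast_ne_top _), one_mul]
        · refine le_trans ?_ le_add_self
          rw [Set.indicator_of_mem hx, Pi.one_apply]
          calc _ ≤ ∫⁻ r, 1 ∂uniformOn (Set.univ : Set (Fin n)) :=
                lintegral_mono fun r => prob_le_one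
            _ = 1 := by simp
    _ = _ := by
        rw [lintegral_add_left measurable_const, lintegral_indicator_one MeasurableSet.of_discrete]
        simp

end Law

/-- The bound on the approximation of PageRank for a good bi-degree sequence. -/
theorem sum_drawLaw_graphRoot_sub_treeRoot_le {x : BiDegree n} (hn : 1 ≤ n) {lam b : ℝ}
    (hlam : 1 < lam) (hx : GoodDegrees lam b x) {c r₀ ε : ℝ} (hc : 0 < c) (hc' : c < 1)
    (hr₀ : 0 ≤ r₀) (hε : 0 < ε) (k : ℕ) {m : ℕ} (hm : 1 ≤ m) :
    ∑ r, drawLaw x.2 r {w | ε < |graphRoot c ((x, r), w) - treeRoot c r₀ k ((x, r), w)|} ≤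
      n * ENNReal.ofReal ((r₀ + 1) * ε⁻¹ * c ^ k +
        (b * (lam ^ k / (lam - 1)) / m + (1 + b) * m ^ 2 / n)) := by
  obtain ⟨N, D⟩ := x
  obtain ⟨hND, hmul, hL, hsq⟩ := hx
  simp only at hND hmul hL hsq ⊢
  have hn' : (0 : ℝ) < n := by exact_mod_cast hn
  have hm' : (1 : ℝ) ≤ m := by exact_mod_cast hm
  have hDpos : (0 : ℝ) < ∑ i, (D i : ℝ) := hn'.trans_le hL
  have hD : 0 < ∑ i, D i := by exact_mod_cast hDpos
  have hb : 0 ≤ b := by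
    have : 0 ≤ b * n := le_trans (by positivity) hsq
    exact nonneg_of_mul_nonneg_left this hn'
  -- Off the last two events the first k generations are copies of distinct nodes, and the tree
  -- value may be replaced by the power iteration.
  have hsub : ∀ r, {w | ε < |graphRoot c (((N, D), r), w) - treeRoot c r₀ k (((N, D), r), w)|} ⊆
      {w | ε < |pageRank c (prMatrix c N D r w) r - powerRank c r₀ (prMatrix c N D r w) k r|} ∪
        ({w | m < treeSize N r w k} ∪ {w | ¬ Set.InjOn (copyOf r w) (Set.Iio m)}) := by
    intro r w hw
    by_contra hcon
    simp only [Set.mem_union, Set.mem_ofPred_eq, not_or, not_not, not_lt] at hcon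
    obtain ⟨h1, h2, h3⟩ := hcon
    rw [powerRank_root_eq_treeRank (h3.mono (Set.Iio_subset_Iio h2))] at h1
    exact absurd hw (not_lt.2 h1)
  have hν : ∀ r, ∫⁻ e, (N e.1 : ℝ≥0∞) ∂stubLaw D r ≤ ENNReal.ofReal lam := by
    intro r
    rw [lintegral_stubLaw_inDegree hD]
    apply ENNReal.ofReal_le_ofReal
    rwa [div_le_iff₀ hDpos]
  have hLb : ((∑ i, N i : ℕ) : ℝ) ≤ b * n := by
    rw [hND]
    push_cast
    refine le_trans (Finset.sum_le_sum fun i _ => ?_) hsq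
    exact_mod_cast Nat.le_self_pow two_ne_zero (D i)
  have hB : (∑ i, (D i : ℝ) ^ 2) / (∑ j, (D j : ℝ)) ^ 2 ≤ b / n := by
    rw [div_le_div_iff₀ (by positivity) hn']
    calc (∑ i, (D i : ℝ) ^ 2) * n ≤ b * n * n := by gcongr
      _ = b * (n : ℝ) ^ 2 := by ring
      _ ≤ _ := by gcongr
  have e2 : ((∑ i, N i : ℕ) : ℝ) * (lam ^ k / (lam - 1)) / m ≤
      n * (b * (lam ^ k / (lam - 1)) / m) := by
    have : 0 ≤ lam ^ k / (lam - 1) := div_nonneg (by positivity) (by linarith)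
    calc _ ≤ b * n * (lam ^ k / (lam - 1)) / m := by gcongr
      _ = _ := by ring
  have e3 : (m : ℝ) + n * (m ^ 2 * ((∑ i, (D i : ℝ) ^ 2) / (∑ j, (D j : ℝ)) ^ 2)) ≤
      n * ((1 + b) * m ^ 2 / n) := by
    calc _ ≤ (m : ℝ) ^ 2 + n * (m ^ 2 * (b / n)) := by
          gcongr
          nlinarith
      _ = _ := by field_simp
  have hl0 : 0 ≤ lam ^ k / (lam - 1) := div_nonneg (by positivity) (by linarith)
  calc _ ≤ ∑ r, (drawLaw D r {w | ε < |pageRank c (prMatrix c N D r w) r -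
          powerRank c r₀ (prMatrix c N D r w) k r|} +
        (drawLaw D r {w | m < treeSize N r w k} +
          drawLaw D r {w | ¬ Set.InjOn (copyOf r w) (Set.Iio m)})) :=
        Finset.sum_le_sum fun r _ => (measure_mono (hsub r)).trans
          ((measure_union_le _ _).trans (by gcongr; exact measure_union_le _ _))
    _ ≤ n * ENNReal.ofReal ((r₀ + 1) * ε⁻¹ * c ^ k) +
        (ENNReal.ofReal (n * (b * (lam ^ k / (lam - 1)) / m)) +
          ENNReal.ofReal (n * ((1 + b) * m ^ 2 / n))) := by
        rw [Finset.sum_add_distrib, Finset.sum_add_distrib]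
        exact add_le_add (sum_drawLaw_pageRank_sub_powerRank_le hND hc hc' hr₀ hε k)
          (add_le_add ((sum_drawLaw_lt_treeSize_le hlam hν k hm).trans
            (ENNReal.ofReal_le_ofReal e2))
            ((sum_drawLaw_not_injOn_le hD m).trans (ENNReal.ofReal_le_ofReal e3)))
    _ = _ := by
        rw [ENNReal.ofReal_mul hn'.le, ENNReal.ofReal_mul hn'.le, ENNReal.ofReal_natCast, ← mul_add,
          ← mul_add, ← ENNReal.ofReal_add (by positivity) (by positivity),
          ← ENNReal.ofReal_add (by positivity) (by positivity)]

/-- The choice of the number `m` of individuals up to which the tree is compared with the graph. -/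
theorem exists_treeSize_bound {h y η lam b : ℝ} (hy : 0 < y) (hlam : lam = Real.exp y)
    (hη : 0 < η) (hη' : h * y + 2 * η ≤ 1 / 2) (hη'' : η ≤ 1 / 2) (hb : 0 < b) (hn : 1 ≤ n) {k : ℕ}
    (hk : (k : ℝ) ≤ h * Real.log n) :
    ∃ m : ℕ, 1 ≤ m ∧ b * (lam ^ k / (lam - 1)) / m + (1 + b) * m ^ 2 / n ≤
      (2 * b / (lam - 1) + (1 + b)) * (n : ℝ) ^ (-η) := by
  have hn1 : (1 : ℝ) ≤ n := by exact_mod_cast hn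
  have hn' : (0 : ℝ) < n := by linarith
  have hl1 : 0 < lam - 1 := by
    have := Real.one_lt_exp_iff.2 hy
    linarith
  -- Markov's inequality for the size needs m of order at least n^(hy + η), and collisions need m² ≤
  -- n^(1 - η); `hη'` makes this exponent satisfy both.
  set x := (n : ℝ) ^ (1 / 2 - η) with hx
  have hx1 : 1 ≤ x := Real.one_le_rpow hn1 (by linarith)
  have hm1 : 1 ≤ ⌊x⌋₊ := (Nat.one_le_floor_iff x).2 hx1
  refine ⟨⌊x⌋₊, hm1, ?_⟩
  have hm1' : (1 : ℝ) ≤ (⌊x⌋₊ : ℝ) := by exact_mod_cast hm1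
  have hmx : (⌊x⌋₊ : ℝ) ≤ x := Nat.floor_le (by linarith)
  have hxm : x / 2 ≤ ⌊x⌋₊ := by
    have := Nat.lt_floor_add_one x
    linarith
  have hpow : lam ^ k ≤ (n : ℝ) ^ (h * y) := by
    rw [hlam, ← Real.exp_nat_mul, Real.rpow_def_of_pos hn']
    apply Real.exp_le_exp.2
    calc (k : ℝ) * y ≤ h * Real.log n * y := by gcongr
      _ = _ := by ring
  have h1 : lam ^ k / ⌊x⌋₊ ≤ 2 * (n : ℝ) ^ (-η) := by
    rw [div_le_iff₀ (by linarith)]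
    calc lam ^ k ≤ (n : ℝ) ^ (h * y) := hpow
      _ ≤ (n : ℝ) ^ (-η + (1 / 2 - η)) := Real.rpow_le_rpow_of_exponent_le hn1 (by linarith)
      _ = 2 * (n : ℝ) ^ (-η) * (x / 2) := by rw [Real.rpow_add hn', ← hx]; ring
      _ ≤ _ := by gcongr
  have h2 : (⌊x⌋₊ : ℝ) ^ 2 / n ≤ (n : ℝ) ^ (-η) := by
    rw [div_le_iff₀ hn']
    calc (⌊x⌋₊ : ℝ) ^ 2 ≤ x ^ 2 := by gcongr
      _ = (n : ℝ) ^ ((1 / 2 - η) * 2) := by rw [hx, Real.rpow_mul hn'.le, Real.rpow_two]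
      _ ≤ (n : ℝ) ^ (-η + 1) := Real.rpow_le_rpow_of_exponent_le hn1 (by linarith)
      _ = _ := by rw [Real.rpow_add hn', Real.rpow_one]
  calc _ = b / (lam - 1) * (lam ^ k / ⌊x⌋₊) + (1 + b) * ((⌊x⌋₊ : ℝ) ^ 2 / n) := by
        field_simp
    _ ≤ b / (lam - 1) * (2 * (n : ℝ) ^ (-η)) + (1 + b) * (n : ℝ) ^ (-η) := by gcongr
    _ = _ := by ring

end DCM

/-! ### The main theorem: choice of the exponents. -/

theorem theorem1
    (Fi Fo : Measure ℕ) [IsProbabilityMeasure Fi] [IsProbabilityMeasure Fo]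
    (α β : ℝ) (hα : 1 < α) (hβ : 2 < β)
    (hFi : DCM.TailBound Fi α) (hFo : DCM.TailBound Fo β)
    (μ : ℝ) (hμi : ∫ k, (k : ℝ) ∂Fi = μ) (hμo : ∫ k, (k : ℝ) ∂Fo = μ) (hμ : 1 < μ)
    (δ₀ : ℝ) (hδ₀ : 0 < δ₀) (hδ₀' : δ₀ < DCM.kappa α β)
    (c : ℝ) (hc : 0 < c) (hc' : c < 1) (r₀ : ℝ) (hr₀ : 0 ≤ r₀)
    (ε : ℝ) (hε : 0 < ε) (h : ℝ) (hh : 0 < h) (hh' : h < 1 / (2 * Real.log μ)) :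
    ∃ δ : ℝ, 0 < δ ∧ ∃ C : ℝ, ∀ᶠ n : ℕ in atTop,
      IsProbabilityMeasure (DCM.law Fi Fo α β δ₀ n) ∧
      ∀ k : ℕ, 1 ≤ k → (k : ℝ) ≤ h * Real.log n →
        (DCM.law Fi Fo α β δ₀ n).real
            {s | ε < |DCM.graphRoot c s - DCM.treeRoot c r₀ k s|}
          ≤ (r₀ + 1) * ε⁻¹ * c ^ k + C * (n : ℝ) ^ (-δ) := by
  have hlog : 0 < Real.log μ := Real.log_pos hμ
  have h1 : Real.log μ < 1 / (2 * h) := by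
    rw [lt_div_iff₀ (by positivity)] at hh' ⊢
    linarith
  -- Here y is log λ: above log μ, so that good degrees are likely, and below 1/(2h), so that λ^k
  -- stays below a power of n less than 1/2.
  obtain ⟨y, hy1, hy2⟩ := exists_between h1
  have hy0 : 0 < y := hlog.trans hy1
  have hhy : h * y < 1 / 2 := by
    rw [lt_div_iff₀ (by positivity)] at hy2
    linarith
  have hhy0 : 0 < h * y := mul_pos hh hy0
  have hlam : μ < Real.exp y := by
    rw [← Real.log_lt_iff_lt_exp (by linarith)]
    exact hy1
  have hlam1 : 1 < Real.exp y := hμ.trans hlam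
  obtain ⟨b, hb, δ₁, hδ₁, C₁, hC₁, hev⟩ := DCM.exists_biDegreeLaw_not_goodDegrees_le hα hβ hFi hFo
    hμi hμo hμ hδ₀ hδ₀' hlam
  -- Half of the slack, so that hy + 2η = 1/2.
  set η := (1 / 2 - h * y) / 2 with hη
  have hη0 : 0 < η := by linarith
  set C₂ := 2 * b / (Real.exp y - 1) + (1 + b) with hC₂
  have hC₂0 : 0 ≤ C₂ := by
    have : 0 < Real.exp y - 1 := by linarith
    positivity
  refine ⟨min η δ₁, lt_min hη0 hδ₁, C₂ + C₁, ?_⟩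
  filter_upwards [hev, eventually_ge_atTop 1] with n ⟨hP, hbad⟩ hn
  have hn1 : (1 : ℝ) ≤ n := by exact_mod_cast hn
  have hprob := DCM.isProbabilityMeasure_law (Fi := Fi) (Fo := Fo) (α := α) (β := β) (δ₀ := δ₀) hn
  refine ⟨hprob, fun k _ hk => ?_⟩
  obtain ⟨m, hm, hmle⟩ := DCM.exists_treeSize_bound (b := b) hy0 rfl hη0 (by linarith)
    (by linarith) hb hn hk
  have hle := DCM.law_le (Fi := Fi) (Fo := Fo) (α := α) (β := β) (δ₀ := δ₀) hn
    {s | ε < |DCM.graphRoot c s - DCM.treeRoot c r₀ k s|} {x | DCM.GoodDegrees (Real.exp y) b x} _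
    fun x hx => DCM.sum_drawLaw_graphRoot_sub_treeRoot_le hn hlam1 hx hc hc' hr₀ hε k hm
  have hreal := ENNReal.toReal_mono
    (ENNReal.add_ne_top.2 ⟨ENNReal.ofReal_ne_top, measure_ne_top _ _⟩) hle
  rw [ENNReal.toReal_add ENNReal.ofReal_ne_top (measure_ne_top _ _)] at hreal
  have hl0 : 0 ≤ Real.exp y ^ k / (Real.exp y - 1) :=
    div_nonneg (by positivity) (by linarith)
  rw [ENNReal.toReal_ofReal (by positivity)] at hreal
  have p1 : (n : ℝ) ^ (-η) ≤ (n : ℝ) ^ (-min η δ₁) :=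
    Real.rpow_le_rpow_of_exponent_le hn1 (by linarith [min_le_left η δ₁])
  have p2 : (n : ℝ) ^ (-δ₁) ≤ (n : ℝ) ^ (-min η δ₁) :=
    Real.rpow_le_rpow_of_exponent_le hn1 (by linarith [min_le_right η δ₁])
  calc _ ≤ _ := hreal
    _ ≤ (r₀ + 1) * ε⁻¹ * c ^ k + C₂ * (n : ℝ) ^ (-η) + C₁ * (n : ℝ) ^ (-δ₁) := by
        refine add_le_add ?_ hbad
        linarith
    _ ≤ (r₀ + 1) * ε⁻¹ * c ^ k + C₂ * (n : ℝ) ^ (-min η δ₁) + C₁ * (n : ℝ) ^ (-min η δ₁) := by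
        gcongr
    _ = _ := by ring
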